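/- Let $B$ be a real separable Banach space with norm $\|\cdot\|$, dual space $B^*$ and duality $\langle\cdot,\cdot\rangle$. Let $\{X_n:n\ge 1\}$ be i.i.d. $B$-valued random variables such that $\mathbb{E}[e^{t\|X_1\|}]<\infty$ for all $t>0$, and put $S_0:=0$ and $S_k:=X_1+\cdots+X_k$ for $k\ge 1$. Let $\{N_n:n\ge 1\}$ be random variables with values in $\{0,1,2,\dots\}$, defined on the same probability space, such that the sequence $\{X_n:n\ge 1\}$ is independent of the sequence $\{N_n:n\ge 1\}$. Assume that for every $\eta\in\mathbb{R}$ the limit $$\Lambda_N(\eta):=\lim_{n\to\infty}\frac1n\log\mathbb{E}[e^{\eta N_n}]$$ exists and is finite, and that the function $\Lambda_N:\mathbb{R}\to\mathbb{R}$ is differentiable. Put $\Lambda_X(\theta):=\log\mathbb{E}[e^{\langle\theta,X_1\rangle}]$ for $\theta\in B^*$, and $$\Lambda_X^*(x):=\sup_{\theta\in B^*}\{\langle\theta,x\rangle-\Lambda_X(\theta)\}\quad(x\in B),\qquad \Lambda_N^*(y):=\sup_{\eta\in\mathbb{R}}\{\eta y-\Lambda_N(\eta)\}\quad(y\in\mathbb{R}),$$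 $$I_{S,N}(x,y):=\sup_{\theta\in B^*,\,\eta\in\mathbb{R}}\{\langle\theta,x\rangle+\eta y-\Lambda_N(\eta+\Lambda_X(\theta))\}\quad((x,y)\in B\times\mathbb{R}).$$ Then $\left\{\left(\frac{S_{N_n}}{n},\frac{N_n}{n}\right):n\ge 1\right\}$ satisfies the large deviation principle on $B\times\mathbb{R}$ with speed $n$ and good rate function $I_{S,N}$. That is, $I_{S,N}$ takes values in $[0,\infty]$, is lower semicontinuous, and has compact level sets $\{I_{S,N}\le a\}$ for all $a\ge 0$; for every open set $O\subset B\times\mathbb{R}$, $$\liminf_{n\to\infty}\frac1n\log P\left(\left(\tfrac{S_{N_n}}{n},\tfrac{N_n}{n}\right)\in O\right)\ge-\inf_{(x,y)\in O}I_{S,N}(x,y);$$ and for every closed set $C\subset B\times\mathbb{R}$, $$\limsup_{n\to\infty}\frac1n\log P\left(\left(\tfrac{S_{N_n}}{n},\tfrac{N_n}{n}\right)\in C\right)\le-\inf_{(x,y)\in C}I_{S,N}(x,y),$$ where $\log 0=-\infty$ and $\inf\emptyset=+\infty$. Moreover, the limit $\Lambda_N(-\infty):=\lim_{\eta\to-\infty}\Lambda_N(\eta)$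 exists in $[-\infty,\infty]$, and $$I_{S,N}(x,y)=\begin{cases}y\,\Lambda_X^*\left(\frac{x}{y}\right)+\Lambda_N^*(y)&\text{if }y>0,\\-\Lambda_N(-\infty)&\text{if }(x,y)=(0,0),\\\infty&\text{otherwise.}\end{cases}$$ -/

import Mathlib

open MeasureTheory ProbabilityTheory Filter Topology

noncomputable section

namespace CompoundLDP

/-- A good rate function: a lower semicontinuous function with values in `[0, ∞]` (seen inside the
extended reals) all of whose level sets are compact. -/
structure IsGoodRateFunction {E : Type*} [TopologicalSpace E] (I : E → EReal) : Prop where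
  nonneg : ∀ x, 0 ≤ I x
  lowerSemicontinuous : LowerSemicontinuous I
  isCompact_level : ∀ a : ℝ, 0 ≤ a → IsCompact {x | I x ≤ (a : EReal)}

/-- The sequence `Z` of `E`-valued random variables satisfies the large deviation principle with
speed `v` (a sequence tending to infinity) and rate function `I`. Logarithms of probabilities are
taken in the extended reals, with `log 0 = -∞`, and the infimum over the empty set is `+∞`. -/
structure SatisfiesLDP {Ω E : Type*} [MeasurableSpace Ω] [TopologicalSpace E]
    (P : Measure Ω) (Z : ℕ → Ω → E) (v : ℕ → ℝ) (I : E → EReal) : Prop where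
  speed : Tendsto v atTop atTop
  nonneg : ∀ x, 0 ≤ I x
  lowerSemicontinuous : LowerSemicontinuous I
  lower : ∀ O : Set E, IsOpen O →
    -(⨅ x ∈ O, I x) ≤ liminf (fun n => ENNReal.log (P (Z n ⁻¹' O)) / (v n : EReal)) atTop
  upper : ∀ C : Set E, IsClosed C →
    limsup (fun n => ENNReal.log (P (Z n ⁻¹' C)) / (v n : EReal)) atTop ≤ -(⨅ x ∈ C, I x)

/-- The partial sum of the first `k` summands. The summands are indexed from `0`, so that `X i`
is the `(i + 1)`-st one. -/
def partialSum {Ω B : Type*} [AddCommMonoid B] (X : ℕ → Ω → B) (k : ℕ) (ω : Ω) : B :=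
  ∑ i ∈ Finset.range k, X i ω

/-- The normalized pair `(S_{N_n} / n, N_n / n)`. -/
def scaledPair {Ω B : Type*} [NormedAddCommGroup B] [NormedSpace ℝ B]
    (X : ℕ → Ω → B) (N : ℕ → Ω → ℕ) (n : ℕ) (ω : Ω) : B × ℝ :=
  ((n : ℝ)⁻¹ • partialSum X (N n ω) ω, (N n ω : ℝ) / n)

/-- The logarithmic moment generating function `θ ↦ log E[exp ⟨θ, Y⟩]` of a `B`-valued random
variable `Y` for which all these expectations are finite. -/
def logMGF {Ω B : Type*} [MeasurableSpace Ω] [NormedAddCommGroup B] [NormedSpace ℝ B]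
    (P : Measure Ω) (Y : Ω → B) (θ : StrongDual ℝ B) : ℝ :=
  Real.log (∫ ω, Real.exp (θ (Y ω)) ∂P)

/-- The Legendre transform, a function on `B`, of a real function on the dual of `B`. -/
def legendreDual {B : Type*} [NormedAddCommGroup B] [NormedSpace ℝ B]
    (Λ : StrongDual ℝ B → ℝ) (x : B) : EReal :=
  ⨆ θ : StrongDual ℝ B, ((θ x - Λ θ : ℝ) : EReal)

/-- The Legendre transform of a real function on `ℝ`. -/
def legendreReal (Λ : ℝ → ℝ) (y : ℝ) : EReal :=
  ⨆ η : ℝ, ((η * y - Λ η : ℝ) : EReal)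

/-- The Legendre transform of `(θ, η) ↦ ΛN (η + ΛX θ)`. -/
def jointRate {B : Type*} [NormedAddCommGroup B] [NormedSpace ℝ B]
    (ΛX : StrongDual ℝ B → ℝ) (ΛN : ℝ → ℝ) (p : B × ℝ) : EReal :=
  ⨆ (θ : StrongDual ℝ B) (η : ℝ), ((θ p.1 + η * p.2 - ΛN (η + ΛX θ) : ℝ) : EReal)

end CompoundLDP

end

/-! Averaging over the summands while `N n` is held fixed replaces each factor `exp ⟨θ, X_i⟩` by
`exp (ΛX θ)`. The pair therefore has limiting log-moment generating function `ΛN (η + ΛX θ)`, which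
is differentiable because `ΛN` and `ΛX` are. What remains is a Gärtner–Ellis theorem on `B × ℝ`,
exponential tightness, and a computation with suprema.

Gärtner–Ellis: Chernoff bounds on half-spaces give the upper bound on compact sets, and tightness
extends it to closed sets. For the lower bound, `exists_hasDerivAt_near` finds a tilt whose gradient
along finitely many forms is close to their values at `z`. It minimises a coercive quadratic
perturbation, so neither convexity of `Λ` nor exposed points enter. `eventually_le_polyhedron` turns
the tilt into a lower bound on weak neighbourhoods. Inside a compact set these are as good as norm
neighbourhoods, and tightness discards the rest.

Tightness (`exponentiallyTight_scaledPair`): the summands are approximated by finitely valued ones.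
The scaled sums of those stay in a compact set while `N n / n` is bounded, and a Chernoff bound
controls the total error.

Explicit rate (`jointRate_eq_add`): the shift `η ↦ η - ΛX θ` splits the joint supremum into a sum of
two. -/

namespace CompoundLDP

/-! ### Finite sums of exponentials are governed by the largest exponent. -/

section Exponentials

theorem eventually_exp_add_exp_le {a b r : ℝ} (ha : a < r) (hb : b < r) :
    ∀ᶠ n : ℕ in atTop, Real.exp (n * a) + Real.exp (n * b) ≤ Real.exp (n * r) := by
  have key : ∀ c : ℝ, c < r → Tendsto (fun n : ℕ => Real.exp (n * (c - r))) atTop (𝓝 0) := by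
    intro c hc
    refine Real.tendsto_exp_atBot.comp ?_
    exact tendsto_natCast_atTop_atTop.atTop_mul_const_of_neg (by linarith)
  have h := (key a ha).add (key b hb)
  rw [add_zero] at h
  filter_upwards [h.eventually_lt_const one_pos] with n hn
  have e : ∀ c : ℝ, Real.exp (n * c) = Real.exp (n * (c - r)) * Real.exp (n * r) := by
    intro c; rw [← Real.exp_add]; ring_nf
  rw [e a, e b, ← add_mul]
  nlinarith [Real.exp_pos (n * r)]

theorem eventually_sum_exp_le {ι : Type*} (s : Finset ι) (a : ι → ℝ) {r : ℝ}
    (ha : ∀ j ∈ s, a j < r) :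
    ∀ᶠ n : ℕ in atTop, ∑ j ∈ s, Real.exp (n * a j) ≤ Real.exp (n * r) := by
  classical
  induction s using Finset.induction_on generalizing r with
  | empty => exact Eventually.of_forall fun n => by simpa using (Real.exp_pos _).le
  | insert j s hj ih =>
    have h1 : ∀ᶠ q in 𝓝[<] r, ∀ i ∈ insert j s, a i < q := by
      rw [Finset.eventually_all]
      intro i hi
      exact eventually_nhdsWithin_of_eventually_nhds (lt_mem_nhds (ha i hi))
    obtain ⟨q, hq, hqr⟩ := (h1.and self_mem_nhdsWithin).exists
    filter_upwards [ih (r := q) (fun i hi => hq i (Finset.mem_insert_of_mem hi)),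
      eventually_exp_add_exp_le (ha j (Finset.mem_insert_self _ _)) hqr] with n h2 h3
    rw [Finset.sum_insert hj]
    linarith

end Exponentials

/-! ### From logarithmic asymptotics to eventual exponential inequalities. -/

section LogConversion

theorem log_div_le_iff {p : ENNReal} {n : ℕ} (hn : 0 < n) (r : ℝ) :
    ENNReal.log p / ((n : ℝ) : EReal) ≤ (r : EReal) ↔ p ≤ ENNReal.ofReal (Real.exp (n * r)) := by
  rw [EReal.div_le_iff_le_mul (by exact_mod_cast hn) (EReal.coe_ne_top _), ← EReal.coe_mul,
    ← Real.log_exp (n * r), ← ENNReal.log_ofReal_of_pos (Real.exp_pos _), ENNReal.log_le_log_iff,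
    Real.log_exp]

theorem lt_log_div_iff {p : ENNReal} {n : ℕ} (hn : 0 < n) (r : ℝ) :
    (r : EReal) < ENNReal.log p / ((n : ℝ) : EReal) ↔ ENNReal.ofReal (Real.exp (n * r)) < p := by
  rw [← not_le, log_div_le_iff hn, not_le]

/-- With its upper counterpart below, this lets the large deviation bounds be proved as inequalities
in `ENNReal`, where `log 0` plays no role. -/
theorem le_liminf_log_div {p : ℕ → ENNReal} {a : EReal}
    (h : ∀ s : ℝ, a < s → ∀ᶠ n : ℕ in atTop, ENNReal.ofReal (Real.exp (-(n * s))) ≤ p n) :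
    -a ≤ liminf (fun n : ℕ => ENNReal.log (p n) / ((n : ℝ) : EReal)) atTop := by
  refine EReal.neg_le_of_neg_le ?_
  refine EReal.le_of_forall_lt_iff_le.1 fun t ht => ?_
  obtain ⟨s, has, hst⟩ := EReal.lt_iff_exists_real_btwn.1 ht
  refine EReal.neg_le_of_neg_le ?_
  refine le_liminf_of_le (by isBoundedDefault) ?_
  filter_upwards [h s has, eventually_gt_atTop 0] with n hn hn0
  rw [← EReal.coe_neg]
  refine le_of_lt ((lt_log_div_iff hn0 _).2 (lt_of_lt_of_le ?_ hn))
  have hst' : s < t := by exact_mod_cast hst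
  have : (0 : ℝ) < n := by exact_mod_cast hn0
  exact (ENNReal.ofReal_lt_ofReal_iff (Real.exp_pos _)).2 (Real.exp_lt_exp.2 (by nlinarith))

theorem limsup_log_div_le {p : ℕ → ENNReal} {a : EReal}
    (h : ∀ s : ℝ, s < a → ∀ᶠ n : ℕ in atTop, p n ≤ ENNReal.ofReal (Real.exp (-(n * s)))) :
    limsup (fun n : ℕ => ENNReal.log (p n) / ((n : ℝ) : EReal)) atTop ≤ -a := by
  refine EReal.le_neg_of_le_neg ?_
  refine EReal.ge_of_forall_gt_iff_ge.1 fun t ht => ?_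
  refine EReal.le_neg_of_le_neg ?_
  refine limsup_le_of_le (by isBoundedDefault) ?_
  filter_upwards [h t ht, eventually_gt_atTop 0] with n hn hn0
  rw [← EReal.coe_neg]
  refine (log_div_le_iff hn0 _).2 (hn.trans_eq ?_)
  ring_nf

end LogConversion

/-! ### The Gärtner–Ellis theorem in a normed space. -/

section GartnerEllis

variable {Ω E : Type*} [MeasurableSpace Ω] [NormedAddCommGroup E] [NormedSpace ℝ E]

/-- `Λ φ` is the limit of `n⁻¹ log E[exp (n φ(Z n))]` for every continuous linear form `φ`. -/
structure HasLimitingLogMGF (P : Measure Ω) (Z : ℕ → Ω → E) (Λ : StrongDual ℝ E → ℝ) : Prop where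
  upper : ∀ φ r, Λ φ < r → ∀ᶠ n : ℕ in atTop,
    ∫⁻ ω, ENNReal.ofReal (Real.exp (n * φ (Z n ω))) ∂P ≤ ENNReal.ofReal (Real.exp (n * r))
  lower : ∀ φ r, r < Λ φ → ∀ᶠ n : ℕ in atTop,
    ENNReal.ofReal (Real.exp (n * r)) ≤ ∫⁻ ω, ENNReal.ofReal (Real.exp (n * φ (Z n ω))) ∂P

/-- Exponential tightness with speed `n`. -/
def ExponentiallyTight (P : Measure Ω) (Z : ℕ → Ω → E) : Prop :=
  ∀ L : ℝ, ∃ K : Set E, IsCompact K ∧ ∀ᶠ n : ℕ in atTop,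
    P (Z n ⁻¹' Kᶜ) ≤ ENNReal.ofReal (Real.exp (-(n * L)))

theorem legendreDual_le_coe_iff {Λ : StrongDual ℝ E → ℝ} {z : E} {a : ℝ} :
    legendreDual Λ z ≤ (a : EReal) ↔ ∀ φ : StrongDual ℝ E, φ z - Λ φ ≤ a := by
  simp only [legendreDual, iSup_le_iff, EReal.coe_le_coe_iff]

theorem legendreDual_nonneg {Λ : StrongDual ℝ E → ℝ} (h0 : Λ 0 = 0) (z : E) :
    0 ≤ legendreDual Λ z := by
  refine le_iSup_of_le 0 ?_
  simp [h0]

theorem lowerSemicontinuous_legendreDual (Λ : StrongDual ℝ E → ℝ) :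
    LowerSemicontinuous (legendreDual Λ) := by
  refine lowerSemicontinuous_iSup fun φ => Continuous.lowerSemicontinuous ?_
  exact continuous_coe_real_ereal.comp (φ.continuous.sub continuous_const)

/-- Near a minimiser of a small quadratic perturbation, the gradient of `Λ` along finitely many
directions is as close as one likes to any point where the Legendre transform is finite. -/
theorem exists_hasDerivAt_near {Λ : StrongDual ℝ E → ℝ} (hΛ : Differentiable ℝ Λ) (h0 : Λ 0 = 0)
    {ι : Type*} [Fintype ι] (φ : ι → StrongDual ℝ E) {z : E} {a : ℝ}
    (ha : ∀ ψ : StrongDual ℝ E, ψ z - Λ ψ ≤ a) {δ : ℝ} (hδ : 0 < δ) :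
    ∃ c : ι → ℝ, (∀ i, HasDerivAt (fun t : ℝ => Λ (∑ j, c j • φ j + t • φ i))
      (φ i z - δ * c i) 0) ∧ δ * ∑ i, c i ^ 2 ≤ 2 * a := by
  classical
  let ℓ : EuclideanSpace ℝ ι → StrongDual ℝ E := fun c => ∑ j, c j • φ j
  have hℓ : Continuous ℓ := by fun_prop
  -- By `ha` the first two terms are at least `-a`, so the quadratic term makes `g` coercive.
  -- Criticality of the minimiser gives the derivatives, and comparison with `g 0 = 0` bounds its
  -- norm.
  let g : EuclideanSpace ℝ ι → ℝ := fun c => Λ (ℓ c) - ℓ c z + δ / 2 * ‖c‖ ^ 2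
  have hg : Continuous g := by
    have h1 : Continuous fun c => ℓ c z := by
      simp only [ℓ, sum_apply, smul_apply]
      fun_prop
    exact ((hΛ.continuous.comp hℓ).sub h1).add (by fun_prop)
  have hlow : ∀ c, -a + δ / 2 * ‖c‖ ^ 2 ≤ g c := fun c => by
    have := ha (ℓ c)
    simp only [g]; linarith
  have hcoer : Tendsto g (cocompact _) atTop := by
    refine tendsto_atTop_mono hlow (tendsto_atTop_add_const_left _ _ ?_)
    refine Tendsto.const_mul_atTop (by positivity) ?_
    exact (tendsto_pow_atTop two_ne_zero).comp tendsto_norm_cocompact_atTop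
  obtain ⟨c, hc⟩ := hg.exists_forall_le hcoer
  refine ⟨fun i => c i, fun i => ?_, ?_⟩
  · have hd : DifferentiableAt ℝ (fun t : ℝ => Λ (ℓ c + t • φ i)) 0 := by
      refine (hΛ _).comp _ ?_
      fun_prop
    have hD := hd.hasDerivAt
    set D := deriv (fun t : ℝ => Λ (ℓ c + t • φ i)) 0 with hDdef
    -- Up to an additive constant, this is `g` along the `i`-th coordinate line through `c`.
    have hh : HasDerivAt (fun t : ℝ => Λ (ℓ c + t • φ i) + (δ * c i - φ i z) * t + δ / 2 * t ^ 2)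
        (D + (δ * c i - φ i z) * 1 + δ / 2 * (2 * (0 : ℝ) ^ 1 * 1)) 0 :=
      (hD.add ((hasDerivAt_id (0 : ℝ)).const_mul _)).add
        (((hasDerivAt_id (0 : ℝ)).pow 2).const_mul _)
    have hmin : IsLocalMin
        (fun t : ℝ => Λ (ℓ c + t • φ i) + (δ * c i - φ i z) * t + δ / 2 * t ^ 2) 0 := by
      refine Eventually.of_forall fun t => ?_
      have h1 := hc (c + t • EuclideanSpace.single i (1 : ℝ))
      have h2 : ℓ (c + t • EuclideanSpace.single i (1 : ℝ)) = ℓ c + t • φ i := by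
        simp [ℓ, add_smul, Finset.sum_add_distrib]
      have h3 : ‖c + t • EuclideanSpace.single i (1 : ℝ)‖ ^ 2 = ‖c‖ ^ 2 + 2 * (t * c i) + t ^ 2 := by
        rw [@norm_add_sq_real, inner_smul_right, EuclideanSpace.inner_single_right, norm_smul]
        simp
      simp only [g, h2, h3, add_apply, smul_apply,
        smul_eq_mul] at h1
      simp only [zero_smul, add_zero, mul_zero]
      nlinarith
    have hz := hmin.hasDerivAt_eq_zero hh
    have : D = φ i z - δ * c i := by linarith
    rw [this] at hD
    exact hD
  · have h1 := (hlow c).trans (hc 0)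
    have h2 : g 0 = 0 := by simp [g, ℓ, h0]
    have h3 : ‖c‖ ^ 2 = ∑ i, c i ^ 2 := EuclideanSpace.real_norm_sq_eq c
    rw [h2, h3] at h1
    linarith

variable [MeasurableSpace E] [BorelSpace E] {P : Measure Ω}
  {Z : ℕ → Ω → E} {Λ : StrongDual ℝ E → ℝ}

theorem measurable_ofReal_exp_dual {Y : Ω → E} (hY : Measurable Y) (φ : StrongDual ℝ E) (t : ℝ) :
    Measurable fun ω => ENNReal.ofReal (Real.exp (t * φ (Y ω))) :=
  ENNReal.measurable_ofReal.comp (Real.measurable_exp.comp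
    ((φ.continuous.measurable.comp hY).const_mul t))

/-- Markov's inequality applied to `exp (n φ(Z n))`. -/
theorem HasLimitingLogMGF.eventually_halfspace_le (h : HasLimitingLogMGF P Z Λ)
    (hZ : ∀ n, Measurable (Z n)) {φ : StrongDual ℝ E} {α r : ℝ} (hr : Λ φ < r) :
    ∀ᶠ n : ℕ in atTop, P (Z n ⁻¹' {w | α + r < φ w}) ≤ ENNReal.ofReal (Real.exp (-(n * α))) := by
  filter_upwards [h.upper φ r hr] with n hn
  have h1 := (mul_meas_ge_le_lintegral (μ := P) (measurable_ofReal_exp_dual (hZ n) φ n)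
    (ENNReal.ofReal (Real.exp (n * (α + r))))).trans hn
  have h2 : ENNReal.ofReal (Real.exp (n * r)) =
      ENNReal.ofReal (Real.exp (n * (α + r))) * ENNReal.ofReal (Real.exp (-(n * α))) := by
    rw [← ENNReal.ofReal_mul (Real.exp_pos _).le, ← Real.exp_add]
    ring_nf
  rw [h2] at h1
  have h3 := (ENNReal.mul_le_mul_iff_right
    (ENNReal.ofReal_pos.2 (Real.exp_pos _)).ne' ENNReal.ofReal_ne_top).1 h1
  refine (measure_mono fun ω hω => ?_).trans h3
  exact ENNReal.ofReal_le_ofReal (Real.exp_le_exp.2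
    (mul_le_mul_of_nonneg_left (le_of_lt hω) n.cast_nonneg))

/-- Upper bound on a compact set. -/
theorem HasLimitingLogMGF.eventually_compact_le (h : HasLimitingLogMGF P Z Λ)
    (hZ : ∀ n, Measurable (Z n)) {K : Set E} (hK : IsCompact K) {s α : ℝ} (hs : s < α)
    (hα : ∀ z ∈ K, (α : EReal) < legendreDual Λ z) :
    ∀ᶠ n : ℕ in atTop, P (Z n ⁻¹' K) ≤ ENNReal.ofReal (Real.exp (-(n * s))) := by
  have hφ : ∀ z ∈ K, ∃ (φ : StrongDual ℝ E) (r : ℝ), Λ φ < r ∧ α + r < φ z := by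
    intro z hz
    obtain ⟨φ, hφ⟩ := lt_iSup_iff.1 (hα z hz)
    have hφ' : α < φ z - Λ φ := by exact_mod_cast hφ
    obtain ⟨r, h1, h2⟩ := exists_between (show Λ φ < φ z - α by linarith)
    exact ⟨φ, r, h1, by linarith⟩
  choose! φ r hr hφr using hφ
  obtain ⟨t, htK, hcov⟩ := hK.elim_nhds_subcover (fun z => {w | α + r z < φ z w}) fun z hz =>
    (isOpen_lt continuous_const (φ z).continuous).mem_nhds (hφr z hz)
  have hev := (Finset.eventually_all t).2 fun z hz =>
    h.eventually_halfspace_le hZ (φ := φ z) (α := α) (hr z (htK z hz))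
  filter_upwards [hev, eventually_sum_exp_le t (fun _ => -α) (r := -s) (fun _ _ => by linarith)]
    with n hn hsum
  calc P (Z n ⁻¹' K) ≤ P (⋃ z ∈ t, Z n ⁻¹' {w | α + r z < φ z w}) := by
        refine measure_mono fun ω hω => ?_
        obtain ⟨z, hz, hzω⟩ := Set.mem_iUnion₂.1 (hcov hω)
        exact Set.mem_iUnion₂.2 ⟨z, hz, hzω⟩
    _ ≤ ∑ z ∈ t, P (Z n ⁻¹' {w | α + r z < φ z w}) := measure_biUnion_finset_le _ _
    _ ≤ ∑ z ∈ t, ENNReal.ofReal (Real.exp (n * -α)) := by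
        refine Finset.sum_le_sum fun z hz => (hn z hz).trans_eq ?_
        rw [mul_neg]
    _ = ENNReal.ofReal (∑ z ∈ t, Real.exp (n * -α)) :=
        (ENNReal.ofReal_sum_of_nonneg fun _ _ => (Real.exp_pos _).le).symm
    _ ≤ _ := by
        rw [← mul_neg]
        exact ENNReal.ofReal_le_ofReal hsum

/-- Upper bound on a closed set, under exponential tightness. -/
theorem HasLimitingLogMGF.eventually_closed_le (h : HasLimitingLogMGF P Z Λ)
    (hZ : ∀ n, Measurable (Z n)) (hT : ExponentiallyTight P Z) {C : Set E} (hC : IsClosed C)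
    {s : ℝ} (hs : (s : EReal) < ⨅ z ∈ C, legendreDual Λ z) :
    ∀ᶠ n : ℕ in atTop, P (Z n ⁻¹' C) ≤ ENNReal.ofReal (Real.exp (-(n * s))) := by
  obtain ⟨α, hsα, hα⟩ := EReal.lt_iff_exists_real_btwn.1 hs
  have hsα' : s < α := by exact_mod_cast hsα
  -- The gap between `q` and `s` absorbs the factor two from the union bound.
  obtain ⟨q, hsq, hqα⟩ := exists_between hsα'
  obtain ⟨K, hK, hKn⟩ := hT q
  filter_upwards [hKn, h.eventually_compact_le hZ (hK.inter_right hC) hqα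
    (fun z hz => hα.trans_le (iInf₂_le z hz.2)),
    eventually_exp_add_exp_le (show -q < -s by linarith) (show -q < -s by linarith)]
    with n h1 h2 h3
  calc P (Z n ⁻¹' C) ≤ P (Z n ⁻¹' Kᶜ ∪ Z n ⁻¹' (K ∩ C)) := by
        refine measure_mono fun ω hω => ?_
        by_cases hk : Z n ω ∈ K
        · exact Or.inr ⟨hk, hω⟩
        · exact Or.inl hk
    _ ≤ _ := (measure_union_le _ _).trans (add_le_add h1 h2)
    _ = ENNReal.ofReal (Real.exp (n * -q) + Real.exp (n * -q)) := by
        rw [ENNReal.ofReal_add (Real.exp_pos _).le (Real.exp_pos _).le, mul_neg]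
    _ ≤ _ := by
        rw [← mul_neg]
        exact ENNReal.ofReal_le_ofReal h3

/-- Exponential tilting by `φ`: if the derivatives of `Λ` at `φ` along the forms `ψ j` are `v j`,
then the polyhedral neighbourhood `{w | ∀ j, ψ j w < v j + ε}` carries the tilted mass. -/
theorem HasLimitingLogMGF.eventually_le_polyhedron (h : HasLimitingLogMGF P Z Λ)
    (hZ : ∀ n, Measurable (Z n)) {J : Type*} [Fintype J] (ψ : J → StrongDual ℝ E) (v : J → ℝ)
    {φ : StrongDual ℝ E} (hd : ∀ j, HasDerivAt (fun t : ℝ => Λ (φ + t • ψ j)) (v j) 0)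
    {ε b s : ℝ} (hε : 0 < ε) (hb : ∀ w, (∀ j, ψ j w < v j + ε) → φ w ≤ b) (hs : b - Λ φ < s) :
    ∀ᶠ n : ℕ in atTop,
      ENNReal.ofReal (Real.exp (-(n * s))) ≤ P (Z n ⁻¹' {w | ∀ j, ψ j w < v j + ε}) := by
  -- For small `t`, tilting further by `t • ψ j` raises `Λ` by less than `t * (v j + ε)`. Hence the
  -- part of `E[exp (n φ(Z n))]` where `ψ j ≥ v j + ε` is exponentially smaller than the whole.
  have ht : ∀ j, ∃ t : ℝ, 0 < t ∧ Λ (φ + t • ψ j) < Λ φ + t * (v j + ε) := by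
    intro j
    have h1 := (hasDerivAt_iff_tendsto_slope_zero.1 (hd j)).eventually_lt_const
      (show v j < v j + ε by linarith)
    have h2 : ∀ᶠ t : ℝ in 𝓝[>] 0, _ := h1.filter_mono
      (nhdsWithin_mono _ fun t (ht : 0 < t) => ht.ne')
    obtain ⟨t, h3, h4⟩ := (h2.and self_mem_nhdsWithin).exists
    have ht0 : (0 : ℝ) < t := h4
    refine ⟨t, ht0, ?_⟩
    simp only [zero_add, zero_smul, add_zero, smul_eq_mul] at h3
    rw [inv_mul_lt_iff₀ ht0] at h3
    linarith
  choose t ht0 ht using ht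
  have hmid : ∀ j, ∃ q, Λ (φ + t j • ψ j) < q ∧ q < Λ φ + t j * (v j + ε) := fun j =>
    exists_between (ht j)
  choose q hq1 hq2 using hmid
  have hr : ∀ᶠ r in 𝓝[<] Λ φ, (∀ j, q j - t j * (v j + ε) < r) ∧ b - s < r := by
    refine (eventually_all.2 fun j => ?_).and ?_
    · exact eventually_nhdsWithin_of_eventually_nhds (lt_mem_nhds (by linarith [hq2 j]))
    · exact eventually_nhdsWithin_of_eventually_nhds (lt_mem_nhds (by linarith))
  obtain ⟨r, ⟨hr1, hr2⟩, hr3⟩ := (hr.and self_mem_nhdsWithin).exists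
  obtain ⟨r', hr4, hr5⟩ : ∃ r', (∀ j, q j - t j * (v j + ε) < r') ∧ r' < r := by
    have hr : ∀ᶠ r' in 𝓝[<] r, (∀ j, q j - t j * (v j + ε) < r') :=
      eventually_all.2 fun j =>
        eventually_nhdsWithin_of_eventually_nhds (lt_mem_nhds (hr1 j))
    exact (hr.and self_mem_nhdsWithin).exists
  have hE1 : ∀ᶠ n : ℕ in atTop, ∀ j, _ := eventually_all.2 fun j => h.upper _ _ (hq1 j)
  filter_upwards [hE1, h.lower φ r hr3,
    eventually_sum_exp_le Finset.univ (fun j => q j - t j * (v j + ε)) (fun j _ => hr4 j),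
    eventually_exp_add_exp_le hr5 hr2] with n h1 h2 h3 h4
  set W : Set E := {w | ∀ j, ψ j w < v j + ε} with hW
  have hWm : MeasurableSet W := by
    have : W = ⋂ j, {w | ψ j w < v j + ε} := by ext; simp [hW]
    rw [this]
    exact MeasurableSet.iInter fun j =>
      (isOpen_lt (ψ j).continuous continuous_const).measurableSet
  -- On `W` the bound `φ ≤ b` is used; off `W` some constraint fails and its Markov term dominates.
  have hpt : ∀ w, ENNReal.ofReal (Real.exp (n * φ w)) ≤
      W.indicator (fun _ => ENNReal.ofReal (Real.exp (n * b))) w +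
      ∑ j, ENNReal.ofReal (Real.exp (n * -(t j * (v j + ε)))) *
        ENNReal.ofReal (Real.exp (n * (φ + t j • ψ j) w)) := by
    intro w
    by_cases hw : w ∈ W
    · rw [Set.indicator_of_mem hw]
      refine le_add_right (ENNReal.ofReal_le_ofReal (Real.exp_le_exp.2 ?_))
      exact mul_le_mul_of_nonneg_left (hb w hw) n.cast_nonneg
    · have : ∃ j, v j + ε ≤ ψ j w := by simpa [hW] using hw
      obtain ⟨j, hj⟩ := this
      refine le_add_left (le_trans ?_ (Finset.single_le_sum (fun _ _ => zero_le)
        (Finset.mem_univ j)))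
      rw [← ENNReal.ofReal_mul (Real.exp_pos _).le, ← Real.exp_add, ← mul_add]
      refine ENNReal.ofReal_le_ofReal (Real.exp_le_exp.2 ?_)
      refine mul_le_mul_of_nonneg_left ?_ n.cast_nonneg
      simp only [add_apply, smul_apply, smul_eq_mul]
      nlinarith [ht0 j]
  have hint : ENNReal.ofReal (Real.exp (n * r)) ≤
      ENNReal.ofReal (Real.exp (n * b)) * P (Z n ⁻¹' W) +
        ENNReal.ofReal (Real.exp (n * r')) := by
    calc _ ≤ ∫⁻ ω, ENNReal.ofReal (Real.exp (n * φ (Z n ω))) ∂P := h2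
      _ ≤ ∫⁻ ω, ((Z n ⁻¹' W).indicator (fun _ => ENNReal.ofReal (Real.exp (n * b))) ω +
            ∑ j, ENNReal.ofReal (Real.exp (n * -(t j * (v j + ε)))) *
            ENNReal.ofReal (Real.exp (n * (φ + t j • ψ j) (Z n ω)))) ∂P :=
          lintegral_mono fun ω => hpt (Z n ω)
      _ = ENNReal.ofReal (Real.exp (n * b)) * P (Z n ⁻¹' W) +
            ∑ j, ENNReal.ofReal (Real.exp (n * -(t j * (v j + ε)))) *
              ∫⁻ ω, ENNReal.ofReal (Real.exp (n * (φ + t j • ψ j) (Z n ω))) ∂P := by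
          rw [lintegral_add_left (measurable_const.indicator (hZ n hWm)),
            lintegral_indicator_const (hZ n hWm), lintegral_finsetSum]
          · congr 1
            exact Finset.sum_congr rfl fun j _ =>
              lintegral_const_mul _ (measurable_ofReal_exp_dual (hZ n) _ _)
          · exact fun j _ => (measurable_ofReal_exp_dual (hZ n) _ _).const_mul _
      _ ≤ _ := by
          gcongr
          refine le_trans (Finset.sum_le_sum fun j _ => mul_le_mul_right (h1 j) _) ?_
          refine le_trans (le_of_eq ?_) (ENNReal.ofReal_le_ofReal h3)
          rw [ENNReal.ofReal_sum_of_nonneg fun _ _ => (Real.exp_pos _).le]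
          refine Finset.sum_congr rfl fun j _ => ?_
          rw [← ENNReal.ofReal_mul (Real.exp_pos _).le, ← Real.exp_add]
          ring_nf
  -- Since `r' < r` and `b - s < r`, removing the off-`W` mass `exp (n r')` from `exp (n r)` still
  -- leaves `exp (n (b - s))`.
  have h5 : ENNReal.ofReal (Real.exp (n * (b - s))) ≤
      ENNReal.ofReal (Real.exp (n * b)) * P (Z n ⁻¹' W) := by
    have := (ENNReal.ofReal_le_ofReal h4).trans hint
    rw [add_comm (Real.exp _), ENNReal.ofReal_add (Real.exp_pos _).le (Real.exp_pos _).le] at this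
    exact ENNReal.le_of_add_le_add_right ENNReal.ofReal_ne_top this
  have h6 : ENNReal.ofReal (Real.exp (n * (b - s))) =
      ENNReal.ofReal (Real.exp (n * b)) * ENNReal.ofReal (Real.exp (-(n * s))) := by
    rw [← ENNReal.ofReal_mul (Real.exp_pos _).le, ← Real.exp_add]
    ring_nf
  rw [h6] at h5
  exact (ENNReal.mul_le_mul_iff_right
    (ENNReal.ofReal_pos.2 (Real.exp_pos _)).ne' ENNReal.ofReal_ne_top).1 h5

/-- Lower bound for weak neighbourhoods. -/
theorem HasLimitingLogMGF.eventually_le_weak_nhds (h : HasLimitingLogMGF P Z Λ)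
    (hZ : ∀ n, Measurable (Z n)) (hΛ : Differentiable ℝ Λ) (h0 : Λ 0 = 0)
    {ι : Type*} [Fintype ι] (φ : ι → StrongDual ℝ E) {z : E} {a s r : ℝ} (hr : 0 < r)
    (ha : legendreDual Λ z ≤ (a : EReal)) (hs : a < s) :
    ∀ᶠ n : ℕ in atTop,
      ENNReal.ofReal (Real.exp (-(n * s))) ≤ P (Z n ⁻¹' {w | ∀ i, |φ i w - φ i z| < r}) := by
  have ha' := legendreDual_le_coe_iff.1 ha
  have ha0 : 0 ≤ a := by exact_mod_cast (legendreDual_nonneg h0 z).trans ha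
  -- The gradient misses `φ i z` by `δ * c i`, whose square is at most `δ * (2 * a)`; this `δ` keeps
  -- the miss below `r / 2`.
  obtain ⟨δ, hδ, hδa⟩ : ∃ δ : ℝ, 0 < δ ∧ δ * (2 * a) < (r / 2) ^ 2 := by
    refine ⟨(r / 2) ^ 2 / (2 * a + 1), by positivity, ?_⟩
    rw [div_mul_eq_mul_div, div_lt_iff₀ (by positivity)]
    nlinarith [sq_pos_of_pos (half_pos hr)]
  obtain ⟨c, hder, hc⟩ := exists_hasDerivAt_near hΛ h0 φ ha' hδ
  have hci : ∀ i, |δ * c i| < r / 2 := by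
    intro i
    refine abs_lt_of_sq_lt_sq ?_ (half_pos hr).le
    have h1 : c i ^ 2 ≤ ∑ i, c i ^ 2 :=
      Finset.single_le_sum (f := fun i => c i ^ 2) (fun _ _ => sq_nonneg _) (Finset.mem_univ i)
    have h2 : δ * c i ^ 2 ≤ 2 * a := (mul_le_mul_of_nonneg_left h1 hδ.le).trans hc
    calc (δ * c i) ^ 2 = δ * (δ * c i ^ 2) := by ring
      _ ≤ δ * (2 * a) := mul_le_mul_of_nonneg_left h2 hδ.le
      _ < _ := hδa
  set S := ∑ i, |c i| with hS
  have hS0 : 0 ≤ S := Finset.sum_nonneg fun _ _ => abs_nonneg _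
  -- `ε` is the other half of the radius `r`, and `ε * S` bounds the variation of the tilting form
  -- over the polyhedron.
  obtain ⟨ε, hε, hεr, hεS⟩ : ∃ ε : ℝ, 0 < ε ∧ ε ≤ r / 2 ∧ ε * S < s - a := by
    refine ⟨min (r / 2) ((s - a) / (S + 1)), lt_min (half_pos hr)
      (div_pos (by linarith) (by linarith)), min_le_left _ _, ?_⟩
    refine (mul_le_mul_of_nonneg_right (min_le_right _ _) hS0).trans_lt ?_
    rw [div_mul_eq_mul_div, div_lt_iff₀ (by linarith)]
    nlinarith
  set u : ι → ℝ := fun i => φ i z - δ * c i with hu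
  have hset : ∀ w, (∀ j : ι ⊕ ι, Sum.elim φ (fun i => -φ i) j w <
      Sum.elim u (fun i => -u i) j + ε) → ∀ i, |φ i w - u i| < ε := by
    intro w hw i
    have h1 := hw (Sum.inl i)
    have h2 := hw (Sum.inr i)
    simp only [Sum.elim_inl, Sum.elim_inr, neg_apply] at h1 h2
    exact abs_lt.2 ⟨by linarith, by linarith⟩
  -- The two-sided constraints around `u i` are encoded as one-sided ones for `φ i` and `-φ i`.
  have hmain := h.eventually_le_polyhedron hZ (J := ι ⊕ ι) (Sum.elim φ fun i => -φ i)
    (Sum.elim u fun i => -u i) (φ := ∑ j, c j • φ j) (ε := ε)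
    (b := ∑ i, c i * u i + ε * S) (s := s) ?_ hε ?_ ?_
  · filter_upwards [hmain] with n hn
    refine hn.trans (measure_mono fun ω hω i => ?_)
    have h1 := abs_lt.1 (hset _ hω i)
    have h2 := abs_lt.1 (hci i)
    simp only [hu] at h1
    exact abs_lt.2 ⟨by linarith [h1.1, h2.1], by linarith [h1.2, h2.2]⟩
  · rintro (i | i)
    · exact hder i
    · have h1 : HasDerivAt (fun t : ℝ => Λ (∑ j, c j • φ j + t • φ i)) (u i) (-0) := by
        simpa using hder i
      have h2 := h1.scomp 0 (hasDerivAt_neg (0 : ℝ))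
      have e : (fun t : ℝ => Λ (∑ j, c j • φ j + t • φ i)) ∘ Neg.neg =
          fun t : ℝ => Λ (∑ j, c j • φ j + t • -φ i) := by
        funext t
        refine congrArg (fun ξ => Λ (∑ j, c j • φ j + ξ)) ?_
        ext w
        simp only [smul_apply, neg_apply, smul_eq_mul]
        ring
      rw [e] at h2
      simpa using h2
  · intro w hw
    have h1 := hset w hw
    simp only [sum_apply, smul_apply, smul_eq_mul]
    rw [hS, Finset.mul_sum, ← Finset.sum_add_distrib]
    refine Finset.sum_le_sum fun i _ => ?_
    have h2 : c i * (φ i w - u i) ≤ |c i| * ε :=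
      (le_abs_self _).trans (by rw [abs_mul]; gcongr; exact (h1 i).le)
    linarith
  -- The perturbation enters with a favourable sign: `∑ c i * u i` is `∑ c i * φ i z` minus `δ * ∑ c
  -- i ^ 2`.
  · have h1 := ha' (∑ j, c j • φ j)
    have h2 : ∑ i, c i * u i = ∑ i, c i * φ i z - δ * ∑ i, c i ^ 2 := by
      rw [Finset.mul_sum, ← Finset.sum_sub_distrib]
      exact Finset.sum_congr rfl fun i _ => by simp only [hu]; ring
    have h3 : 0 ≤ δ * ∑ i, c i ^ 2 :=
      mul_nonneg hδ.le (Finset.sum_nonneg fun _ _ => sq_nonneg _)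
    simp only [sum_apply, smul_apply, smul_eq_mul] at h1
    linarith

/-- Lower bound for open sets, under exponential tightness. -/
theorem HasLimitingLogMGF.eventually_le_open (h : HasLimitingLogMGF P Z Λ)
    (hZ : ∀ n, Measurable (Z n)) (hT : ExponentiallyTight P Z) (hΛ : Differentiable ℝ Λ)
    (h0 : Λ 0 = 0) {O : Set E} (hO : IsOpen O) {z : E} (hz : z ∈ O) {s : ℝ}
    (hs : legendreDual Λ z < (s : EReal)) :
    ∀ᶠ n : ℕ in atTop, ENNReal.ofReal (Real.exp (-(n * s))) ≤ P (Z n ⁻¹' O) := by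
  obtain ⟨a, ha, has⟩ := EReal.lt_iff_exists_real_btwn.1 hs
  have has' : a < s := by exact_mod_cast has
  obtain ⟨q, haq, hqs⟩ := exists_between has'
  obtain ⟨K, hK, hKn⟩ := hT s
  -- By compactness of `K \ O`, finitely many of these forms define a weak neighbourhood of `z` that
  -- meets `K` only inside `O`.
  have hsep : ∀ w ∈ K \ O, ∃ φ : StrongDual ℝ E, 1 < |φ w - φ z| := by
    intro w hw
    have hne : w - z ≠ 0 := sub_ne_zero.2 fun e => hw.2 (e ▸ hz)
    obtain ⟨φ, hφ⟩ := SeparatingDual.exists_eq_one (R := ℝ) hne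
    refine ⟨(2 : ℝ) • φ, ?_⟩
    rw [map_sub] at hφ
    have : ((2 : ℝ) • φ) w - ((2 : ℝ) • φ) z = 2 := by
      simp only [smul_apply, smul_eq_mul]; linarith
    rw [this]; norm_num
  choose! φ hφ using hsep
  obtain ⟨t, -, hcov⟩ := (hK.diff hO).elim_nhds_subcover
    (fun w => {w' | 1 < |φ w w' - φ w z|}) fun w hw =>
      (isOpen_lt continuous_const (((φ w).continuous.sub continuous_const).abs)).mem_nhds (hφ w hw)
  filter_upwards [h.eventually_le_weak_nhds hZ hΛ h0 (fun w : t => φ w) one_pos ha.le haq, hKn,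
    eventually_exp_add_exp_le (show -s < -q by linarith) (show -s < -q by linarith)]
    with n h1 h2 h3
  have h4 : P (Z n ⁻¹' {w' | ∀ i : t, |φ i w' - φ i z| < 1}) ≤ P (Z n ⁻¹' O) + P (Z n ⁻¹' Kᶜ) := by
    refine (measure_mono fun ω hω => ?_).trans (measure_union_le _ _)
    by_contra hcon
    simp only [Set.mem_union, Set.mem_preimage, Set.mem_compl_iff, not_or, not_not] at hcon
    obtain ⟨w, hw, hw'⟩ := Set.mem_iUnion₂.1 (hcov ⟨hcon.2, hcon.1⟩)
    exact lt_asymm hw' (hω ⟨w, hw⟩)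
  have h5 : ENNReal.ofReal (Real.exp (-(n * s))) + ENNReal.ofReal (Real.exp (-(n * s))) ≤
      P (Z n ⁻¹' O) + ENNReal.ofReal (Real.exp (-(n * s))) := by
    refine le_trans ?_ ((h1.trans h4).trans (add_le_add_right h2 _))
    rw [← ENNReal.ofReal_add (Real.exp_pos _).le (Real.exp_pos _).le, ← mul_neg, ← mul_neg]
    exact ENNReal.ofReal_le_ofReal h3
  exact ENNReal.le_of_add_le_add_right ENNReal.ofReal_ne_top h5

/-- The Gärtner–Ellis theorem for a differentiable limit and an exponentially tight sequence. -/
theorem HasLimitingLogMGF.satisfiesLDP (h : HasLimitingLogMGF P Z Λ)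
    (hZ : ∀ n, Measurable (Z n)) (hT : ExponentiallyTight P Z) (hΛ : Differentiable ℝ Λ)
    (h0 : Λ 0 = 0) : SatisfiesLDP P Z (fun n => (n : ℝ)) (legendreDual Λ) where
  speed := tendsto_natCast_atTop_atTop
  nonneg := legendreDual_nonneg h0
  lowerSemicontinuous := lowerSemicontinuous_legendreDual Λ
  lower O hO := by
    refine le_liminf_log_div fun s hs => ?_
    simp only [iInf_lt_iff] at hs
    obtain ⟨z, hz, hzs⟩ := hs
    exact h.eventually_le_open hZ hT hΛ h0 hO hz hzs
  upper C hC := limsup_log_div_le fun s hs => h.eventually_closed_le hZ hT hC hs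

/-- A point of the level set outside a compact `K` would force mass `exp (-n (a + 1))` on the open
set `Kᶜ`, whereas tightness allows only `exp (-n (a + 2))`. The level set is thus a closed subset of
`K`. -/
theorem HasLimitingLogMGF.isGoodRateFunction (h : HasLimitingLogMGF P Z Λ)
    (hZ : ∀ n, Measurable (Z n)) (hT : ExponentiallyTight P Z) (hΛ : Differentiable ℝ Λ)
    (h0 : Λ 0 = 0) : IsGoodRateFunction (legendreDual Λ) where
  nonneg := legendreDual_nonneg h0
  lowerSemicontinuous := lowerSemicontinuous_legendreDual Λ
  isCompact_level a _ := by
    obtain ⟨K, hK, hKn⟩ := hT (a + 2)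
    refine hK.of_isClosed_subset
      ((lowerSemicontinuous_legendreDual Λ).isClosed_preimage _) fun z hz => ?_
    by_contra hzK
    have hz' : legendreDual Λ z ≤ (a : EReal) := hz
    have h1 := h.eventually_le_open hZ hT hΛ h0 hK.isClosed.isOpen_compl hzK (s := a + 1)
      (hz'.trans_lt (by exact_mod_cast lt_add_one a))
    obtain ⟨n, ⟨hn1, hn2⟩, hn0⟩ := ((h1.and hKn).and (eventually_gt_atTop 0)).exists
    have hn3 := hn1.trans hn2
    rw [ENNReal.ofReal_le_ofReal_iff (Real.exp_pos _).le, Real.exp_le_exp] at hn3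
    have : (0 : ℝ) < n := by exact_mod_cast hn0
    nlinarith

end GartnerEllis

end CompoundLDP

namespace CompoundLDP

/-! ### Exponential moments of compound sums. -/

section CompoundMoments

variable {Ω B : Type*} [MeasurableSpace Ω] [MeasurableSpace B] {P : Measure Ω} {X : ℕ → Ω → B}

theorem lintegral_prod_range_iid (hX_meas : ∀ i, Measurable (X i)) (hX_indep : iIndepFun X P)
    (hX_ident : ∀ i, IdentDistrib (X i) (X 0) P P) {f : B → ENNReal} (hf : Measurable f) (k : ℕ) :
    ∫⁻ ω, ∏ i ∈ Finset.range k, f (X i ω) ∂P = (∫⁻ ω, f (X 0 ω) ∂P) ^ k := by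
  have : IsProbabilityMeasure P := hX_indep.isProbabilityMeasure
  induction k with
  | zero => simp
  | succ k ih =>
    have hm : ∀ i, Measurable (f ∘ X i) := fun i => hf.comp (hX_meas i)
    have h1 := (hX_indep.comp (fun _ => f) fun _ => hf).indepFun_prod_range_succ hm k
    have hp : Measurable (∏ j ∈ Finset.range k, f ∘ X j) := by
      convert Finset.measurable_fun_prod (Finset.range k) fun i _ => hm i using 1
      ext ω
      exact Finset.prod_apply _ _ _
    have h2 := lintegral_mul_eq_lintegral_mul_lintegral_of_indepFun hp (hm k) h1
    simp only [Pi.mul_apply, Finset.prod_apply, Function.comp_apply] at h2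
    simp only [Finset.prod_range_succ]
    rw [h2, ih, pow_succ]
    congr 1
    exact ((hX_ident k).comp hf).lintegral_eq

/-- The moment formula for random products of independent identically distributed factors. -/
theorem lintegral_compound_prod (hX_meas : ∀ i, Measurable (X i)) (hX_indep : iIndepFun X P)
    (hX_ident : ∀ i, IdentDistrib (X i) (X 0) P P) {M : Ω → ℕ} (hM : Measurable M)
    (hXM : IndepFun (fun ω i => X i ω) M P) {f : B → ENNReal} (hf : Measurable f)
    (g : ℕ → ENNReal) :
    ∫⁻ ω, g (M ω) * ∏ i ∈ Finset.range (M ω), f (X i ω) ∂P =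
      ∫⁻ ω, g (M ω) * (∫⁻ ω', f (X 0 ω') ∂P) ^ M ω ∂P := by
  have hMm : ∀ k, Measurable fun ω => ({k} : Set ℕ).indicator (1 : ℕ → ENNReal) (M ω) := fun k =>
    (measurable_of_countable (({k} : Set ℕ).indicator 1)).comp hM
  -- Splitting over the values of `M` by indicators makes the number of factors deterministic, so
  -- independence applies term by term.
  have hsplit : ∀ F : ℕ → Ω → ENNReal, (∀ k, Measurable (F k)) →
      ∫⁻ ω, F (M ω) ω ∂P =
        ∑' k, ∫⁻ ω, F k ω * ({k} : Set ℕ).indicator 1 (M ω) ∂P := by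
    intro F hF
    rw [← lintegral_tsum]
    · refine lintegral_congr fun ω => ?_
      rw [tsum_eq_single (M ω)]
      · simp
      · intro k hk
        simp [Set.indicator_of_notMem, Ne.symm hk]
    · intro k
      exact ((hF k).mul (hMm k)).aemeasurable
  have hpm : ∀ k, Measurable fun ω => ∏ i ∈ Finset.range k, f (X i ω) := fun k =>
    Finset.measurable_fun_prod _ fun i _ => hf.comp (hX_meas i)
  rw [hsplit (fun k ω => g k * ∏ i ∈ Finset.range k, f (X i ω)) fun k => (hpm k).const_mul _,
    hsplit (fun k _ => g k * (∫⁻ ω', f (X 0 ω') ∂P) ^ k) fun k => measurable_const]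
  refine tsum_congr fun k => ?_
  have hind : IndepFun (fun ω => ∏ i ∈ Finset.range k, f (X i ω))
      (fun ω => ({k} : Set ℕ).indicator (1 : ℕ → ENNReal) (M ω)) P := by
    refine hXM.comp (φ := fun x : ℕ → B => ∏ i ∈ Finset.range k, f (x i))
      (ψ := ({k} : Set ℕ).indicator (1 : ℕ → ENNReal)) ?_ (measurable_of_countable _)
    exact Finset.measurable_fun_prod _ fun i _ => hf.comp (measurable_pi_apply i)
  have h1 := lintegral_mul_eq_lintegral_mul_lintegral_of_indepFun (hpm k) (hMm k) hind
  simp only [Pi.mul_apply] at h1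
  have h2 : Measurable fun ω =>
      (∏ i ∈ Finset.range k, f (X i ω)) * ({k} : Set ℕ).indicator (1 : ℕ → ENNReal) (M ω) :=
    (hpm k).mul (hMm k)
  simp only [mul_assoc]
  rw [lintegral_const_mul _ h2, h1,
    lintegral_prod_range_iid hX_meas hX_indep hX_ident hf,
    lintegral_const_mul _ ((hMm k).const_mul _), lintegral_const_mul _ (hMm k)]

/-- Serves twice: a continuous form `D` gives the limiting log-moment generating function, and an
approximation error `D` gives tightness. -/
theorem lintegral_exp_compound (hX_meas : ∀ i, Measurable (X i)) (hX_indep : iIndepFun X P)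
    (hX_ident : ∀ i, IdentDistrib (X i) (X 0) P P) {M : Ω → ℕ} (hM : Measurable M)
    (hXM : IndepFun (fun ω i => X i ω) M P) {D : B → ℝ} (hD : Measurable D) (η : ℝ) :
    ∫⁻ ω, ENNReal.ofReal (Real.exp (∑ i ∈ Finset.range (M ω), D (X i ω) + η * M ω)) ∂P =
      ∫⁻ ω, ENNReal.ofReal (Real.exp (η * M ω)) *
        (∫⁻ ω', ENNReal.ofReal (Real.exp (D (X 0 ω'))) ∂P) ^ M ω ∂P := by
  rw [← lintegral_compound_prod hX_meas hX_indep hX_ident hM hXM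
    (f := fun x => ENNReal.ofReal (Real.exp (D x)))
    (ENNReal.measurable_ofReal.comp (Real.measurable_exp.comp hD))
    (fun k => ENNReal.ofReal (Real.exp (η * k)))]
  refine lintegral_congr fun ω => ?_
  rw [← ENNReal.ofReal_prod_of_nonneg fun _ _ => (Real.exp_pos _).le,
    ← ENNReal.ofReal_mul (Real.exp_pos _).le, ← Real.exp_sum, ← Real.exp_add, add_comm]

end CompoundMoments

/-! ### Differentiability of the logarithmic moment generating function on the dual. -/

section LogMGF

variable {Ω B : Type*} [MeasurableSpace Ω] [NormedAddCommGroup B] [NormedSpace ℝ B]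
  {P : Measure Ω} {Y : Ω → B}

theorem logMGF_zero [IsProbabilityMeasure P] : logMGF P Y 0 = 0 := by
  simp [logMGF]

variable [MeasurableSpace B] [BorelSpace B]

theorem integrable_exp_dual (hY : Measurable Y)
    (hexp : ∀ t : ℝ, 0 < t → Integrable (fun ω => Real.exp (t * ‖Y ω‖)) P) (θ : StrongDual ℝ B) :
    Integrable (fun ω => Real.exp (θ (Y ω))) P := by
  refine (hexp (‖θ‖ + 1) (by positivity)).mono'
    (Real.measurable_exp.comp (θ.continuous.measurable.comp hY)).aestronglyMeasurable
    (Eventually.of_forall fun ω => ?_)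
  rw [Real.norm_eq_abs, Real.abs_exp]
  refine Real.exp_le_exp.2 ((le_abs_self _).trans ((θ.le_opNorm _).trans ?_))
  gcongr
  linarith

theorem integral_exp_dual_pos [NeZero P] (hY : Measurable Y)
    (hexp : ∀ t : ℝ, 0 < t → Integrable (fun ω => Real.exp (t * ‖Y ω‖)) P) (θ : StrongDual ℝ B) :
    0 < ∫ ω, Real.exp (θ (Y ω)) ∂P :=
  integral_exp_pos (integrable_exp_dual hY hexp θ)

theorem lintegral_exp_dual [NeZero P] (hY : Measurable Y)
    (hexp : ∀ t : ℝ, 0 < t → Integrable (fun ω => Real.exp (t * ‖Y ω‖)) P) (θ : StrongDual ℝ B) :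
    ∫⁻ ω, ENNReal.ofReal (Real.exp (θ (Y ω))) ∂P =
      ENNReal.ofReal (Real.exp (logMGF P Y θ)) := by
  rw [← ofReal_integral_eq_lintegral_ofReal (integrable_exp_dual hY hexp θ)
    (Eventually.of_forall fun _ => (Real.exp_pos _).le), logMGF,
    Real.exp_log (integral_exp_dual_pos hY hexp θ)]

theorem differentiable_logMGF [NeZero P] [SecondCountableTopology B] (hY : Measurable Y)
    (hexp : ∀ t : ℝ, 0 < t → Integrable (fun ω => Real.exp (t * ‖Y ω‖)) P) :
    Differentiable ℝ (logMGF P Y) := by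
  intro θ₀
  refine DifferentiableAt.log ?_ (integral_exp_dual_pos hY hexp θ₀).ne'
  have h := hasFDerivAt_integral_of_dominated_of_fderiv_le (𝕜 := ℝ) (μ := P) (x₀ := θ₀)
    (s := Metric.ball θ₀ 1) (F := fun θ ω => Real.exp (θ (Y ω)))
    (F' := fun θ ω => Real.exp (θ (Y ω)) • NormedSpace.inclusionInDoubleDual ℝ B (Y ω))
    -- One unit pays for the radius of the ball, the other for the factor `‖Y‖ ≤ exp ‖Y‖` from the
    -- derivative.
    (bound := fun ω => Real.exp ((‖θ₀‖ + 2) * ‖Y ω‖))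
    (Metric.ball_mem_nhds _ one_pos)
    (Eventually.of_forall fun θ => (integrable_exp_dual hY hexp θ).aestronglyMeasurable)
    (integrable_exp_dual hY hexp θ₀) ?_ ?_ (hexp _ (by positivity)) ?_
  · exact h.differentiableAt
  -- The bidual need not be separable; strong measurability is inherited from `Y` through a
  -- continuous map.
  · have hc : Continuous fun y : B => Real.exp (θ₀ y) • NormedSpace.inclusionInDoubleDual ℝ B y := by
      fun_prop
    exact (hc.comp_stronglyMeasurable hY.stronglyMeasurable).aestronglyMeasurable
  · refine Eventually.of_forall fun ω θ hθ => ?_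
    have h1 : ‖θ‖ ≤ ‖θ₀‖ + 1 := by
      have := norm_le_norm_add_norm_sub' θ θ₀
      rw [mem_ball_iff_norm] at hθ
      linarith
    have h2 : θ (Y ω) ≤ (‖θ₀‖ + 1) * ‖Y ω‖ :=
      (le_abs_self _).trans ((θ.le_opNorm _).trans (by gcongr))
    have h3 : ‖NormedSpace.inclusionInDoubleDual ℝ B (Y ω)‖ ≤ ‖Y ω‖ :=
      NormedSpace.double_dual_bound ℝ B _
    have h4 : ‖Y ω‖ ≤ Real.exp ‖Y ω‖ := by linarith [Real.add_one_le_exp ‖Y ω‖]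
    rw [norm_smul, Real.norm_eq_abs, Real.abs_exp]
    calc _ ≤ Real.exp ((‖θ₀‖ + 1) * ‖Y ω‖) * Real.exp ‖Y ω‖ := by
          gcongr
          exact h3.trans h4
      _ = _ := by rw [← Real.exp_add]; ring_nf
  · refine Eventually.of_forall fun ω θ _ => ?_
    exact ((NormedSpace.inclusionInDoubleDual ℝ B (Y ω)).hasFDerivAt (x := θ)).exp

end LogMGF

/-! ### The rate function as a Legendre transform and its explicit form. -/

section JointRate

variable {B : Type*} [NormedAddCommGroup B] [NormedSpace ℝ B]

/-- The function `(θ, η) ↦ ΛN (η + ΛX θ)` as a function on the dual of `B × ℝ`. -/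
def compoundLogMGF (ΛX : StrongDual ℝ B → ℝ) (ΛN : ℝ → ℝ) (φ : StrongDual ℝ (B × ℝ)) : ℝ :=
  ΛN (φ (0, 1) + ΛX (φ.comp (ContinuousLinearMap.inl ℝ B ℝ)))

theorem dual_prod_apply (φ : StrongDual ℝ (B × ℝ)) (x : B) (y : ℝ) :
    φ (x, y) = φ.comp (ContinuousLinearMap.inl ℝ B ℝ) x + φ (0, 1) * y := by
  have : (x, y) = (x, 0) + y • ((0, 1) : B × ℝ) := by simp
  rw [this, map_add, map_smul, smul_eq_mul, mul_comm y]
  rfl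

theorem jointRate_eq_legendreDual (ΛX : StrongDual ℝ B → ℝ) (ΛN : ℝ → ℝ) :
    jointRate ΛX ΛN = legendreDual (compoundLogMGF ΛX ΛN) := by
  funext ⟨x, y⟩
  refine le_antisymm (iSup₂_le fun θ η => ?_) (iSup_le fun φ => ?_)
  · let φ : StrongDual ℝ (B × ℝ) := θ.coprod (η • ContinuousLinearMap.id ℝ ℝ)
    have h1 : φ.comp (ContinuousLinearMap.inl ℝ B ℝ) = θ := by ext; simp [φ]
    have h2 : φ (0, 1) = η := by simp [φ]
    refine le_iSup_of_le φ ?_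
    rw [compoundLogMGF, dual_prod_apply, h1, h2]
  · refine le_iSup₂_of_le (φ.comp (ContinuousLinearMap.inl ℝ B ℝ)) (φ (0, 1)) ?_
    rw [compoundLogMGF, dual_prod_apply]

theorem differentiable_compoundLogMGF {ΛX : StrongDual ℝ B → ℝ} {ΛN : ℝ → ℝ}
    (hX : Differentiable ℝ ΛX) (hN : Differentiable ℝ ΛN) :
    Differentiable ℝ (compoundLogMGF ΛX ΛN) := by
  refine hN.comp (Differentiable.add ?_ (hX.comp ?_))
  · fun_prop
  · fun_prop

/-- For fixed `θ`, the variable `η + ΛX θ` ranges over all of `ℝ`; taking it in place of `η`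
decouples the two suprema. All cases of the explicit formula follow from this. -/
theorem jointRate_eq_add (ΛX : StrongDual ℝ B → ℝ) (ΛN : ℝ → ℝ) (x : B) (y : ℝ) :
    jointRate ΛX ΛN (x, y) =
      (⨆ θ : StrongDual ℝ B, ((θ x - y * ΛX θ : ℝ) : EReal)) + legendreReal ΛN y := by
  refine le_antisymm (iSup₂_le fun θ η => ?_) (EReal.add_le_of_forall_lt fun a ha b hb => ?_)
  · have h : θ x + η * y - ΛN (η + ΛX θ) =
        (θ x - y * ΛX θ) + ((η + ΛX θ) * y - ΛN (η + ΛX θ)) := by ring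
    simp only [h]
    rw [EReal.coe_add]
    exact add_le_add (le_iSup (fun θ : StrongDual ℝ B => ((θ x - y * ΛX θ : ℝ) : EReal)) θ)
      (le_iSup (fun η : ℝ => ((η * y - ΛN η : ℝ) : EReal)) _)
  · obtain ⟨θ, hθ⟩ := lt_iSup_iff.1 ha
    obtain ⟨η, hη⟩ := lt_iSup_iff.1 hb
    refine (add_le_add hθ.le hη.le).trans ?_
    refine le_iSup₂_of_le θ (η - ΛX θ) ?_
    rw [← EReal.coe_add, EReal.coe_le_coe_iff, sub_add_cancel]
    simp only
    linarith

theorem iSup_scaled_eq_mul_legendreDual (ΛX : StrongDual ℝ B → ℝ) (x : B) {y : ℝ} (hy : 0 < y) :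
    (⨆ θ : StrongDual ℝ B, ((θ x - y * ΛX θ : ℝ) : EReal)) =
      (y : EReal) * legendreDual ΛX (y⁻¹ • x) := by
  have hy' : (0 : EReal) < (y : EReal) := by exact_mod_cast hy
  refine eq_of_forall_ge_iff fun c => ?_
  rw [mul_comm, ← EReal.le_div_iff_mul_le hy' (EReal.coe_ne_top _), legendreDual, iSup_le_iff,
    iSup_le_iff]
  refine forall_congr' fun θ => ?_
  rw [EReal.le_div_iff_mul_le hy' (EReal.coe_ne_top _), ← EReal.coe_mul]
  have : (θ (y⁻¹ • x) - ΛX θ) * y = θ x - y * ΛX θ := by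
    rw [map_smul, smul_eq_mul]
    field_simp
  rw [this]

theorem jointRate_of_pos (ΛX : StrongDual ℝ B → ℝ) (ΛN : ℝ → ℝ) (x : B) {y : ℝ} (hy : 0 < y) :
    jointRate ΛX ΛN (x, y) =
      (y : EReal) * legendreDual ΛX (y⁻¹ • x) + legendreReal ΛN y := by
  rw [jointRate_eq_add, iSup_scaled_eq_mul_legendreDual ΛX x hy]

theorem legendreReal_ne_bot (ΛN : ℝ → ℝ) (y : ℝ) : legendreReal ΛN y ≠ ⊥ := by
  refine (lt_of_lt_of_le (EReal.bot_lt_coe _)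
    (le_iSup (fun η : ℝ => ((η * y - ΛN η : ℝ) : EReal)) 0)).ne'

theorem jointRate_zero (ΛX : StrongDual ℝ B → ℝ) (ΛN : ℝ → ℝ) :
    jointRate ΛX ΛN (0, 0) = -⨅ η : ℝ, (ΛN η : EReal) := by
  rw [jointRate_eq_add, legendreReal]
  refine eq_of_forall_ge_iff fun c => ?_
  rw [EReal.neg_le]
  simp [EReal.neg_le]

theorem jointRate_zero_right_of_ne (ΛX : StrongDual ℝ B → ℝ) (ΛN : ℝ → ℝ) {x : B} (hx : x ≠ 0) :
    jointRate ΛX ΛN (x, 0) = ⊤ := by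
  rw [jointRate_eq_add]
  have h : (⨆ θ : StrongDual ℝ B, ((θ x - 0 * ΛX θ : ℝ) : EReal)) = ⊤ := by
    refine EReal.eq_top_iff_forall_lt _ |>.2 fun c => ?_
    obtain ⟨θ, hθ⟩ := SeparatingDual.exists_eq_one (R := ℝ) hx
    refine lt_iSup_iff.2 ⟨(c + 1) • θ, ?_⟩
    rw [EReal.coe_lt_coe_iff]
    simp [hθ]
  rw [h, EReal.top_add_of_ne_bot (legendreReal_ne_bot _ _)]

theorem jointRate_of_neg {ΛX : StrongDual ℝ B → ℝ} {ΛN : ℝ → ℝ} (hN : ∀ η ≤ 0, ΛN η ≤ 0) (x : B)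
    {y : ℝ} (hy : y < 0) : jointRate ΛX ΛN (x, y) = ⊤ := by
  rw [jointRate_eq_add]
  have h : legendreReal ΛN y = ⊤ := by
    refine EReal.eq_top_iff_forall_lt _ |>.2 fun c => ?_
    -- At this nonpositive `η` one has `η * y = |c| + 1` and `ΛN η ≤ 0`, so the supremum exceeds
    -- `c`.
    have h1 : (|c| + 1) / y ≤ 0 := div_nonpos_of_nonneg_of_nonpos (by positivity) hy.le
    refine lt_iSup_iff.2 ⟨(|c| + 1) / y, ?_⟩
    rw [EReal.coe_lt_coe_iff, div_mul_cancel₀ _ hy.ne]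
    linarith [hN _ h1, le_abs_self c]
  rw [h, EReal.add_top_of_ne_bot]
  exact (lt_of_lt_of_le (EReal.bot_lt_coe _)
    (le_iSup (fun θ : StrongDual ℝ B => ((θ x - y * ΛX θ : ℝ) : EReal)) 0)).ne'

end JointRate

end CompoundLDP

namespace CompoundLDP

/-! ### Compactness criteria and finitely valued approximation. -/

section Tightness

/-- Bounds outside of neighbourhoods of compact sets suffice for exponential tightness. -/
theorem exponentiallyTight_of_thickening {Ω E : Type*} [MeasurableSpace Ω] [NormedAddCommGroup E]
    [CompleteSpace E] [SecondCountableTopology E] [MeasurableSpace E] [BorelSpace E]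
    {P : Measure Ω} [IsFiniteMeasure P] {Z : ℕ → Ω → E} (hZ : ∀ n, Measurable (Z n))
    (h : ∀ L ε : ℝ, 0 < ε → ∃ K : Set E, IsCompact K ∧ ∀ᶠ n : ℕ in atTop,
      P (Z n ⁻¹' (Metric.thickening ε K)ᶜ) ≤ ENNReal.ofReal (Real.exp (-(n * L)))) :
    ExponentiallyTight P Z := by
  -- Countably many radii are combined below, so the bounds must hold for all `n` rather than past
  -- thresholds depending on the radius. Tightness of each single law handles the finitely many
  -- early `n`.
  have hall : ∀ L ε : ℝ, 0 < ε → ∃ K : Set E, IsCompact K ∧ ∀ n : ℕ,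
      P (Z n ⁻¹' (Metric.thickening ε K)ᶜ) ≤ ENNReal.ofReal (Real.exp (-(n * L))) := by
    intro L ε hε
    obtain ⟨K, hK, hKn⟩ := h L ε hε
    obtain ⟨n₀, hn₀⟩ := eventually_atTop.1 hKn
    have hT : ∀ n, ∃ K' : Set E, IsCompact K' ∧
        P (Z n ⁻¹' K'ᶜ) ≤ ENNReal.ofReal (Real.exp (-(n * L))) := by
      intro n
      obtain ⟨K', hK', hle⟩ := isTightMeasureSet_iff_exists_isCompact_measure_compl_le.1
        (isTightMeasureSet_singleton (μ := P.map (Z n))) _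
        (ENNReal.ofReal_pos.2 (Real.exp_pos (-(n * L))))
      refine ⟨K', hK', ?_⟩
      rw [← Measure.map_apply (hZ n) hK'.isClosed.measurableSet.compl]
      exact hle _ rfl
    choose K' hK' hK'n using hT
    refine ⟨K ∪ ⋃ n ∈ Finset.range n₀, K' n,
      hK.union ((Finset.range n₀).isCompact_biUnion fun n _ => hK' n), fun n => ?_⟩
    rcases le_or_gt n₀ n with hn | hn
    · refine (measure_mono (Set.preimage_mono (Set.compl_subset_compl.2 ?_))).trans (hn₀ n hn)
      exact Metric.thickening_subset_of_subset _ Set.subset_union_left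
    · refine (measure_mono (Set.preimage_mono (Set.compl_subset_compl.2 ?_))).trans (hK'n n)
      refine Set.Subset.trans ?_ (Metric.self_subset_thickening hε _)
      exact (Set.subset_biUnion_of_mem (u := fun n => K' n) (Finset.mem_range.2 hn)).trans
        Set.subset_union_right
  intro L
  -- The extra rate `m + 1` yields, for `n ≥ 1`, factors at most `2⁻¹ ^ (m + 1)`, which sum to one.
  choose K hK hKn using fun m : ℕ => hall (L + (m + 1)) (1 / (m + 1)) (by positivity)
  refine ⟨⋂ m : ℕ, Metric.cthickening (1 / (m + 1)) (K m), ?_, ?_⟩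
  · refine isCompact_iff_totallyBounded_isComplete.2 ⟨?_,
      (isClosed_iInter fun m => Metric.isClosed_cthickening).isComplete⟩
    refine Metric.totallyBounded_iff.2 fun ε hε => ?_
    obtain ⟨m, hm⟩ := exists_nat_one_div_lt (half_pos hε)
    obtain ⟨t, ht, hcov⟩ := Metric.totallyBounded_iff.1 (hK m).totallyBounded _ (half_pos hε)
    refine ⟨t, ht, fun w hw => ?_⟩
    have h1 := Metric.cthickening_subset_thickening' (half_pos hε) hm (K m) (Set.mem_iInter.1 hw m)
    obtain ⟨k, hk, hwk⟩ := Metric.mem_thickening_iff.1 h1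
    obtain ⟨y, hy, hky⟩ := Set.mem_iUnion₂.1 (hcov hk)
    refine Set.mem_iUnion₂.2 ⟨y, hy, ?_⟩
    rw [Metric.mem_ball] at hky ⊢
    linarith [dist_triangle w k y]
  · filter_upwards [eventually_ge_atTop 1] with n hn
    have hn' : (1 : ℝ) ≤ n := by exact_mod_cast hn
    calc P (Z n ⁻¹' (⋂ m : ℕ, Metric.cthickening (1 / (m + 1)) (K m))ᶜ)
        ≤ P (⋃ m : ℕ, Z n ⁻¹' (Metric.thickening (1 / (m + 1)) (K m))ᶜ) := by
          refine measure_mono ?_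
          rw [Set.compl_iInter, Set.preimage_iUnion]
          exact Set.iUnion_mono fun m => Set.preimage_mono
            (Set.compl_subset_compl.2 (Metric.thickening_subset_cthickening _ _))
      _ ≤ ∑' m : ℕ, P (Z n ⁻¹' (Metric.thickening (1 / (m + 1)) (K m))ᶜ) :=
          measure_iUnion_le _
      _ ≤ ∑' m : ℕ, ENNReal.ofReal (Real.exp (-(n * L))) * 2⁻¹ ^ (m + 1) := by
          refine ENNReal.tsum_le_tsum fun m => (hKn m n).trans ?_
          have h2 : (2⁻¹ : ENNReal) ^ (m + 1) = ENNReal.ofReal (2⁻¹ ^ (m + 1)) := by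
            rw [ENNReal.ofReal_pow (by norm_num), ENNReal.ofReal_inv_of_pos two_pos]
            simp
          rw [h2, ← ENNReal.ofReal_mul (Real.exp_pos _).le]
          refine ENNReal.ofReal_le_ofReal ?_
          have h3 : Real.exp (-1) ≤ 2⁻¹ := by
            rw [Real.exp_neg]
            exact inv_anti₀ two_pos (by linarith [Real.add_one_le_exp 1])
          calc Real.exp (-(n * (L + (m + 1))))
              ≤ Real.exp (-(n * L)) * Real.exp (-1) ^ (m + 1) := by
                rw [← Real.exp_nat_mul, ← Real.exp_add]
                refine Real.exp_le_exp.2 ?_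
                push_cast
                have : (0 : ℝ) ≤ m := m.cast_nonneg
                nlinarith
            _ ≤ _ := by gcongr
      _ = ENNReal.ofReal (Real.exp (-(n * L))) := by
          rw [ENNReal.tsum_mul_left, ENNReal.tsum_geometric_add_one, ENNReal.one_sub_inv_two,
            inv_inv, ENNReal.inv_mul_cancel two_ne_zero ENNReal.ofNat_ne_top, mul_one]

/-- The scaled sum is `k / n` times an average of points of `F`, and the convex hull of a finite set
is compact. Inserting `0` into the hull covers `k = 0`. -/
theorem exists_isCompact_scaled_sum_mem {B : Type*} [NormedAddCommGroup B] [NormedSpace ℝ B]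
    {F : Set B} (hF : F.Finite) (R : ℝ) :
    ∃ K : Set B, IsCompact K ∧ ∀ (n k : ℕ) (y : ℕ → B), 0 < n → (∀ i, y i ∈ F) →
      (k : ℝ) / n ≤ R → (n : ℝ)⁻¹ • ∑ i ∈ Finset.range k, y i ∈ K := by
  refine ⟨(fun p : ℝ × B => p.1 • p.2) '' (Set.Icc 0 R ×ˢ convexHull ℝ (insert 0 F)),
    (isCompact_Icc.prod ((hF.insert 0).isCompact_convexHull ℝ)).image continuous_smul, ?_⟩
  intro n k y hn hy hk
  have hn' : (0 : ℝ) < n := by exact_mod_cast hn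
  rcases Nat.eq_zero_or_pos k with rfl | hk0
  · refine ⟨(0, 0), ⟨⟨le_rfl, by simpa using hk⟩, subset_convexHull _ _ (by simp)⟩, by simp⟩
  · have hk' : (0 : ℝ) < k := by exact_mod_cast hk0
    refine ⟨((k : ℝ) / n, ∑ i ∈ Finset.range k, (k : ℝ)⁻¹ • y i), ⟨⟨by positivity, hk⟩, ?_⟩, ?_⟩
    · change ∑ i ∈ Finset.range k, (k : ℝ)⁻¹ • y i ∈ convexHull ℝ (insert 0 F)
      refine (convex_convexHull ℝ _).sum_mem (w := fun _ => (k : ℝ)⁻¹)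
        (fun _ _ => by positivity) ?_ fun i _ =>
        subset_convexHull _ _ (Set.mem_insert_of_mem _ (hy i))
      simp [hk'.ne']
    · simp only
      rw [← Finset.smul_sum, smul_smul]
      congr 1
      field_simp

/-- A variable with all exponential moments is approximated by simple functions of itself. -/
theorem exists_simpleFunc_lintegral_exp_lt {Ω B : Type*} [MeasurableSpace Ω] {P : Measure Ω}
    [IsProbabilityMeasure P] [NormedAddCommGroup B] [MeasurableSpace B] [BorelSpace B]
    [SecondCountableTopology B] {Y : Ω → B}
    (hY : Measurable Y) {t : ℝ} (ht : 0 < t)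
    (hexp : Integrable (fun ω => Real.exp (t * ‖Y ω‖)) P) {η : ℝ} (hη : 0 < η) :
    ∃ y : SimpleFunc B B, ∫⁻ ω, ENNReal.ofReal (Real.exp (t * ‖Y ω - y (Y ω)‖)) ∂P <
      ENNReal.ofReal (Real.exp η) := by
  -- Approximation from the base point `0` gives `‖x - y k x‖ ≤ ‖x‖`, hence domination; the
  -- integrals tend to `1 < exp η`.
  let y : ℕ → SimpleFunc B B :=
    SimpleFunc.approxOn (fun x : B => x) measurable_id Set.univ 0 (Set.mem_univ _)
  have hle : ∀ k x, ‖x - y k x‖ ≤ ‖x‖ := by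
    intro k x
    have h := SimpleFunc.edist_approxOn_le (f := fun x : B => x) measurable_id
      (Set.mem_univ (0 : B)) x k
    rw [edist_dist, edist_dist, ENNReal.ofReal_le_ofReal_iff dist_nonneg, dist_zero_left,
      dist_comm, dist_eq_norm] at h
    exact h
  have hlim : ∀ x, Tendsto (fun k => y k x) atTop (𝓝 x) := fun x =>
    SimpleFunc.tendsto_approxOn (f := fun x : B => x) measurable_id (Set.mem_univ (0 : B))
      (by simp)
  have hconv : Tendsto (fun k => ∫⁻ ω, ENNReal.ofReal (Real.exp (t * ‖Y ω - y k (Y ω)‖)) ∂P)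
      atTop (𝓝 (∫⁻ _, 1 ∂P)) := by
    refine tendsto_lintegral_of_dominated_convergence
      (fun ω => ENNReal.ofReal (Real.exp (t * ‖Y ω‖))) (fun k => ?_) (fun k => ?_) ?_ ?_
    · exact ENNReal.measurable_ofReal.comp (Real.measurable_exp.comp
        ((hY.sub ((y k).measurable.comp hY)).norm.const_mul t))
    · refine Eventually.of_forall fun ω => ENNReal.ofReal_le_ofReal (Real.exp_le_exp.2 ?_)
      exact mul_le_mul_of_nonneg_left (hle k _) ht.le
    · rw [← ofReal_integral_eq_lintegral_ofReal hexp
        (Eventually.of_forall fun _ => (Real.exp_pos _).le)]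
      exact ENNReal.ofReal_ne_top
    · refine Eventually.of_forall fun ω => ?_
      have hc : Continuous fun x : B => ENNReal.ofReal (Real.exp (t * ‖Y ω - x‖)) :=
        ENNReal.continuous_ofReal.comp (by fun_prop)
      simpa [Function.comp_def] using (hc.tendsto _).comp (hlim (Y ω))
  have h1 : ∫⁻ _, 1 ∂P < ENNReal.ofReal (Real.exp η) := by
    rw [lintegral_const, measure_univ, mul_one, ← ENNReal.ofReal_one]
    exact (ENNReal.ofReal_lt_ofReal_iff (Real.exp_pos _)).2 (Real.one_lt_exp_iff.2 hη)
  obtain ⟨k, hk⟩ := (hconv.eventually_lt_const h1).exists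
  exact ⟨y k, hk⟩

end Tightness

/-! ### Limiting moments and exponential tightness of the scaled pair. -/

section Compound

variable {Ω : Type*} [MeasurableSpace Ω]

theorem measurable_random_index {γ : Type*} [MeasurableSpace γ] {F : ℕ → Ω → γ}
    (hF : ∀ k, Measurable (F k)) {M : Ω → ℕ} (hM : Measurable M) :
    Measurable fun ω => F (M ω) ω := by
  have h : Measurable fun p : ℕ × Ω => F p.1 p.2 := measurable_from_prod_countable_right hF
  exact h.comp (hM.prodMk measurable_id)

section CountingLimit

variable {P : Measure Ω} {N : ℕ → Ω → ℕ} {ΛN : ℝ → ℝ}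

theorem eventually_counting_mgf_le {η : ℝ} (hlim : Tendsto
      (fun n : ℕ =>
        ENNReal.log (∫⁻ ω, ENNReal.ofReal (Real.exp (η * (N n ω : ℝ))) ∂P) / (n : EReal))
      atTop (𝓝 (ΛN η : EReal))) {r : ℝ} (hr : ΛN η < r) :
    ∀ᶠ n : ℕ in atTop, ∫⁻ ω, ENNReal.ofReal (Real.exp (η * (N n ω : ℝ))) ∂P ≤
      ENNReal.ofReal (Real.exp (n * r)) := by
  filter_upwards [hlim.eventually_lt_const (EReal.coe_lt_coe_iff.2 hr), eventually_gt_atTop 0]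
    with n hn hn0
  exact (log_div_le_iff hn0 r).1 hn.le

theorem eventually_le_counting_mgf {η : ℝ} (hlim : Tendsto
      (fun n : ℕ =>
        ENNReal.log (∫⁻ ω, ENNReal.ofReal (Real.exp (η * (N n ω : ℝ))) ∂P) / (n : EReal))
      atTop (𝓝 (ΛN η : EReal))) {r : ℝ} (hr : r < ΛN η) :
    ∀ᶠ n : ℕ in atTop, ENNReal.ofReal (Real.exp (n * r)) ≤
      ∫⁻ ω, ENNReal.ofReal (Real.exp (η * (N n ω : ℝ))) ∂P := by
  filter_upwards [hlim.eventually_const_lt (EReal.coe_lt_coe_iff.2 hr), eventually_gt_atTop 0]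
    with n hn hn0
  exact ((lt_log_div_iff hn0 r).1 hn).le

theorem counting_limit_zero [IsProbabilityMeasure P] (hlim : ∀ η : ℝ, Tendsto
      (fun n : ℕ =>
        ENNReal.log (∫⁻ ω, ENNReal.ofReal (Real.exp (η * (N n ω : ℝ))) ∂P) / (n : EReal))
      atTop (𝓝 (ΛN η : EReal))) : ΛN 0 = 0 := by
  have h := hlim 0
  simp only [zero_mul, Real.exp_zero, ENNReal.ofReal_one, lintegral_const, measure_univ, mul_one,
    ENNReal.log_one, EReal.zero_div] at h
  exact_mod_cast tendsto_nhds_unique h tendsto_const_nhds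

theorem monotone_counting_limit (hlim : ∀ η : ℝ, Tendsto
      (fun n : ℕ =>
        ENNReal.log (∫⁻ ω, ENNReal.ofReal (Real.exp (η * (N n ω : ℝ))) ∂P) / (n : EReal))
      atTop (𝓝 (ΛN η : EReal))) : Monotone ΛN := by
  intro a b hab
  refine EReal.coe_le_coe_iff.1 (le_of_tendsto_of_tendsto' (hlim a) (hlim b) fun n => ?_)
  refine EReal.div_le_div_right_of_nonneg (by positivity) (ENNReal.log_monotone ?_)
  refine lintegral_mono fun ω => ENNReal.ofReal_le_ofReal (Real.exp_le_exp.2 ?_)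
  gcongr

end CountingLimit

section CompoundSum

variable {B : Type*} [MeasurableSpace B] {P : Measure Ω} {X : ℕ → Ω → B}
  {N : ℕ → Ω → ℕ} {ΛN : ℝ → ℝ}

/-- A Chernoff bound for compound sums. -/
theorem eventually_compound_sum_le (hX_meas : ∀ i, Measurable (X i)) (hX_indep : iIndepFun X P)
    (hX_ident : ∀ i, IdentDistrib (X i) (X 0) P P) (hN_meas : ∀ n, Measurable (N n))
    (hXN : ∀ n, IndepFun (fun ω i => X i ω) (N n) P) {η : ℝ}
    (hlim : Tendsto
      (fun n : ℕ =>
        ENNReal.log (∫⁻ ω, ENNReal.ofReal (Real.exp (η * (N n ω : ℝ))) ∂P) / (n : EReal))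
      atTop (𝓝 (ΛN η : EReal)))
    {D : B → ℝ} (hD : Measurable D)
    (hDη : ∫⁻ ω, ENNReal.ofReal (Real.exp (D (X 0 ω))) ∂P ≤ ENNReal.ofReal (Real.exp η))
    {r c : ℝ} (hr : ΛN η < r) :
    ∀ᶠ n : ℕ in atTop, P {ω | n * c ≤ ∑ i ∈ Finset.range (N n ω), D (X i ω)} ≤
      ENNReal.ofReal (Real.exp (-(n * (c - r)))) := by
  filter_upwards [eventually_counting_mgf_le hlim hr] with n hn
  have hm : Measurable fun ω =>
      ENNReal.ofReal (Real.exp (∑ i ∈ Finset.range (N n ω), D (X i ω))) :=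
    measurable_random_index
      (F := fun k ω => ENNReal.ofReal (Real.exp (∑ i ∈ Finset.range k, D (X i ω))))
      (fun k => ENNReal.measurable_ofReal.comp (Real.measurable_exp.comp
        (Finset.measurable_fun_sum _ fun i _ => hD.comp (hX_meas i)))) (hN_meas n)
  have h1 : ∫⁻ ω, ENNReal.ofReal (Real.exp (∑ i ∈ Finset.range (N n ω), D (X i ω))) ∂P ≤
      ENNReal.ofReal (Real.exp (n * r)) := by
    refine le_trans ?_ hn
    have h2 := lintegral_exp_compound hX_meas hX_indep hX_ident (hN_meas n) (hXN n) hD 0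
    simp only [zero_mul, add_zero, Real.exp_zero, ENNReal.ofReal_one, one_mul] at h2
    rw [h2]
    refine lintegral_mono fun ω => ?_
    calc _ ≤ ENNReal.ofReal (Real.exp η) ^ N n ω := by gcongr
      _ = _ := by
        rw [← ENNReal.ofReal_pow (Real.exp_pos _).le, ← Real.exp_nat_mul, mul_comm]
  have h3 := (mul_meas_ge_le_lintegral (μ := P) hm (ENNReal.ofReal (Real.exp (n * c)))).trans h1
  have h4 : ENNReal.ofReal (Real.exp (n * r)) =
      ENNReal.ofReal (Real.exp (n * c)) * ENNReal.ofReal (Real.exp (-(n * (c - r)))) := by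
    rw [← ENNReal.ofReal_mul (Real.exp_pos _).le, ← Real.exp_add]
    ring_nf
  rw [h4] at h3
  refine le_trans (measure_mono fun ω hω => ?_) ((ENNReal.mul_le_mul_iff_right
    (ENNReal.ofReal_pos.2 (Real.exp_pos _)).ne' ENNReal.ofReal_ne_top).1 h3)
  exact ENNReal.ofReal_le_ofReal (Real.exp_le_exp.2 hω)

variable [NormedAddCommGroup B] [NormedSpace ℝ B] [BorelSpace B]

theorem lintegral_exp_scaledPair [NeZero P] (hX_meas : ∀ i, Measurable (X i))
    (hX_indep : iIndepFun X P) (hX_ident : ∀ i, IdentDistrib (X i) (X 0) P P)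
    (hX_exp : ∀ t : ℝ, 0 < t → Integrable (fun ω => Real.exp (t * ‖X 0 ω‖)) P)
    (hN_meas : ∀ n, Measurable (N n))
    (hXN : ∀ n, IndepFun (fun ω i => X i ω) (N n) P) (φ : StrongDual ℝ (B × ℝ)) {n : ℕ}
    (hn : 0 < n) :
    ∫⁻ ω, ENNReal.ofReal (Real.exp (n * φ (scaledPair X N n ω))) ∂P =
      ∫⁻ ω, ENNReal.ofReal (Real.exp ((φ (0, 1) +
        logMGF P (X 0) (φ.comp (ContinuousLinearMap.inl ℝ B ℝ))) * N n ω)) ∂P := by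
  have hn' : (n : ℝ) ≠ 0 := by exact_mod_cast hn.ne'
  set θ := φ.comp (ContinuousLinearMap.inl ℝ B ℝ) with hθ
  have h1 : ∀ ω, n * φ (scaledPair X N n ω) =
      ∑ i ∈ Finset.range (N n ω), θ (X i ω) + φ (0, 1) * N n ω := by
    intro ω
    rw [scaledPair, dual_prod_apply, ← hθ, map_smul, partialSum, map_sum, smul_eq_mul]
    field_simp
  simp only [h1]
  rw [lintegral_exp_compound hX_meas hX_indep hX_ident (hN_meas n) (hXN n)
    θ.continuous.measurable, lintegral_exp_dual (hX_meas 0) hX_exp]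
  refine lintegral_congr fun ω => ?_
  rw [← ENNReal.ofReal_pow (Real.exp_pos _).le, ← Real.exp_nat_mul,
    ← ENNReal.ofReal_mul (Real.exp_pos _).le, ← Real.exp_add]
  ring_nf

theorem hasLimitingLogMGF_scaledPair [NeZero P] (hX_meas : ∀ i, Measurable (X i))
    (hX_indep : iIndepFun X P) (hX_ident : ∀ i, IdentDistrib (X i) (X 0) P P)
    (hX_exp : ∀ t : ℝ, 0 < t → Integrable (fun ω => Real.exp (t * ‖X 0 ω‖)) P)
    (hN_meas : ∀ n, Measurable (N n))
    (hXN : ∀ n, IndepFun (fun ω i => X i ω) (N n) P)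
    (hlim : ∀ η : ℝ, Tendsto
      (fun n : ℕ =>
        ENNReal.log (∫⁻ ω, ENNReal.ofReal (Real.exp (η * (N n ω : ℝ))) ∂P) / (n : EReal))
      atTop (𝓝 (ΛN η : EReal))) :
    HasLimitingLogMGF P (scaledPair X N) (compoundLogMGF (logMGF P (X 0)) ΛN) where
  upper φ r hr := by
    filter_upwards [eventually_counting_mgf_le (hlim _) hr, eventually_gt_atTop 0] with n hn hn0
    rwa [lintegral_exp_scaledPair hX_meas hX_indep hX_ident hX_exp hN_meas hXN φ hn0]
  lower φ r hr := by
    filter_upwards [eventually_le_counting_mgf (hlim _) hr, eventually_gt_atTop 0] with n hn hn0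
    rwa [lintegral_exp_scaledPair hX_meas hX_indep hX_ident hX_exp hN_meas hXN φ hn0]

variable [SecondCountableTopology B]

theorem measurable_scaledPair (hX_meas : ∀ i, Measurable (X i)) (hN_meas : ∀ n, Measurable (N n))
    (n : ℕ) : Measurable (scaledPair X N n) := by
  refine Measurable.prodMk ?_ ?_
  · refine Measurable.const_smul ?_ _
    exact measurable_random_index (F := fun k ω => partialSum X k ω)
      (fun k => Finset.measurable_fun_sum _ fun i _ => hX_meas i) (hN_meas n)
  · exact ((measurable_of_countable (fun k : ℕ => (k : ℝ))).comp (hN_meas n)).div_const _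

/-- Outside the thickening of a suitable compact set, either `N n / n` is large or the sum of the
errors `‖X i - y (X i)‖` is at least `n * (ε / 2)`. Each event has a Chernoff bound. -/
theorem exponentiallyTight_scaledPair [CompleteSpace B] [IsProbabilityMeasure P]
    (hX_meas : ∀ i, Measurable (X i))
    (hX_indep : iIndepFun X P) (hX_ident : ∀ i, IdentDistrib (X i) (X 0) P P)
    (hX_exp : ∀ t : ℝ, 0 < t → Integrable (fun ω => Real.exp (t * ‖X 0 ω‖)) P)
    (hN_meas : ∀ n, Measurable (N n))
    (hXN : ∀ n, IndepFun (fun ω i => X i ω) (N n) P)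
    (hlim : ∀ η : ℝ, Tendsto
      (fun n : ℕ =>
        ENNReal.log (∫⁻ ω, ENNReal.ofReal (Real.exp (η * (N n ω : ℝ))) ∂P) / (n : EReal))
      atTop (𝓝 (ΛN η : EReal)))
    (hcont : Continuous ΛN) : ExponentiallyTight P (scaledPair X N) := by
  refine exponentiallyTight_of_thickening (measurable_scaledPair hX_meas hN_meas) fun L ε hε => ?_
  -- The error event has rate `t * (ε / 2) - 1 / 2`, which must exceed `L`. With `t` fixed, `y` is
  -- taken so fine that each error factor costs at most `exp η`, where `ΛN η < 1 / 2`.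
  obtain ⟨t, ht, htL⟩ : ∃ t : ℝ, 0 < t ∧ L + 2 ≤ t * (ε / 2) := by
    refine ⟨(|L| + 2) / (ε / 2), by positivity, ?_⟩
    rw [div_mul_cancel₀ _ (by positivity)]
    linarith [le_abs_self L]
  obtain ⟨η, hη, hΛη⟩ : ∃ η : ℝ, 0 < η ∧ ΛN η < 1 / 2 := by
    have h1 : ∀ᶠ η in 𝓝[>] (0 : ℝ), ΛN η < 1 / 2 := by
      refine eventually_nhdsWithin_of_eventually_nhds ?_
      refine hcont.continuousAt.eventually_lt_const ?_
      rw [counting_limit_zero hlim]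
      norm_num
    obtain ⟨η, h2, h3⟩ := (h1.and self_mem_nhdsWithin).exists
    exact ⟨η, h3, h2⟩
  obtain ⟨y, hy⟩ := exists_simpleFunc_lintegral_exp_lt (hX_meas 0) ht (hX_exp t ht) hη
  obtain ⟨K, hK, hKmem⟩ := exists_isCompact_scaled_sum_mem y.finite_range (L + 1 + (ΛN 1 + 1))
  refine ⟨K ×ˢ Set.Icc 0 (L + 1 + (ΛN 1 + 1)), hK.prod isCompact_Icc, ?_⟩
  have hMGF := hasLimitingLogMGF_scaledPair hX_meas hX_indep hX_ident hX_exp hN_meas hXN hlim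
  -- The projection to the count corresponds to `θ = 0`, `η = 1`; its half-space bound has rate `L +
  -- 1` beyond the level `L + 1 + (ΛN 1 + 1)`.
  have hsnd : compoundLogMGF (logMGF P (X 0)) ΛN (ContinuousLinearMap.snd ℝ B ℝ) < ΛN 1 + 1 := by
    have h1 : (ContinuousLinearMap.snd ℝ B ℝ).comp (ContinuousLinearMap.inl ℝ B ℝ) = 0 := by
      ext; simp
    rw [compoundLogMGF, h1, logMGF_zero]
    simp
  filter_upwards [hMGF.eventually_halfspace_le (measurable_scaledPair hX_meas hN_meas)
      (α := L + 1) hsnd,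
    eventually_compound_sum_le hX_meas hX_indep hX_ident hN_meas hXN (hlim η)
      (D := fun x => t * ‖x - y x‖) ((measurable_id.sub y.measurable).norm.const_mul t) hy.le
      (c := t * (ε / 2)) hΛη,
    eventually_exp_add_exp_le (show -(L + 1) < -L by linarith)
      (show -(t * (ε / 2) - 1 / 2) < -L by linarith), eventually_gt_atTop 0] with n h1 h2 h3 hn
  have hn' : (0 : ℝ) < n := by exact_mod_cast hn
  calc _ ≤ P (scaledPair X N n ⁻¹'
          {w | L + 1 + (ΛN 1 + 1) < ContinuousLinearMap.snd ℝ B ℝ w} ∪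
        {ω | n * (t * (ε / 2)) ≤ ∑ i ∈ Finset.range (N n ω), t * ‖X i ω - y (X i ω)‖}) := by
        refine measure_mono fun ω hω => ?_
        by_contra hcon
        simp only [Set.mem_union, Set.mem_preimage, Set.mem_ofPred_eq, not_or, not_lt,
          not_le] at hcon
        obtain ⟨hc1, hc2⟩ := hcon
        refine hω (Metric.mem_thickening_iff.2
          ⟨((n : ℝ)⁻¹ • ∑ i ∈ Finset.range (N n ω), y (X i ω), (N n ω : ℝ) / n),
            ⟨hKmem n _ (fun i => y (X i ω)) hn (fun i => Set.mem_range_self _) hc1,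
              by positivity, hc1⟩, ?_⟩)
        rw [scaledPair, Prod.dist_eq, dist_self, max_eq_left dist_nonneg, dist_eq_norm,
          partialSum, ← smul_sub, ← Finset.sum_sub_distrib, norm_smul, norm_inv,
          Real.norm_of_nonneg hn'.le, inv_mul_lt_iff₀ hn']
        refine (norm_sum_le _ _).trans_lt ?_
        rw [← Finset.mul_sum, mul_left_comm] at hc2
        have h4 := lt_of_mul_lt_mul_left hc2 ht.le
        nlinarith
    _ ≤ _ := (measure_union_le _ _).trans (add_le_add h1 h2)
    _ = ENNReal.ofReal (Real.exp (n * -(L + 1)) + Real.exp (n * -(t * (ε / 2) - 1 / 2))) := by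
        rw [ENNReal.ofReal_add (Real.exp_pos _).le (Real.exp_pos _).le, mul_neg, mul_neg]
    _ ≤ _ := by
        rw [← mul_neg]
        exact ENNReal.ofReal_le_ofReal h3

end CompoundSum

end Compound

end CompoundLDP

theorem proposition3p1 {Ω : Type*} [MeasurableSpace Ω] (P : Measure Ω) [IsProbabilityMeasure P]
    {B : Type*} [NormedAddCommGroup B] [NormedSpace ℝ B] [CompleteSpace B]
    [TopologicalSpace.SeparableSpace B] [MeasurableSpace B] [BorelSpace B]
    (X : ℕ → Ω → B) (N : ℕ → Ω → ℕ) (ΛN : ℝ → ℝ)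
    (hX_meas : ∀ i, Measurable (X i))
    (hX_indep : iIndepFun X P)
    (hX_ident : ∀ i, IdentDistrib (X i) (X 0) P P)
    (hX_exp : ∀ t : ℝ, 0 < t → Integrable (fun ω => Real.exp (t * ‖X 0 ω‖)) P)
    (hN_meas : ∀ n, Measurable (N n))
    (hXN : IndepFun (fun ω i => X i ω) (fun ω n => N n ω) P)
    (hΛN_lim : ∀ η : ℝ, Tendsto
      (fun n : ℕ =>
        ENNReal.log (∫⁻ ω, ENNReal.ofReal (Real.exp (η * (N n ω : ℝ))) ∂P) / (n : EReal))
      atTop (𝓝 (ΛN η : EReal)))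
    (hΛN_diff : Differentiable ℝ ΛN) :
    CompoundLDP.SatisfiesLDP P (CompoundLDP.scaledPair X N) (fun n => (n : ℝ))
      (CompoundLDP.jointRate (CompoundLDP.logMGF P (X 0)) ΛN) ∧
    CompoundLDP.IsGoodRateFunction (CompoundLDP.jointRate (CompoundLDP.logMGF P (X 0)) ΛN) ∧
    ∃ ΛN_bot : EReal,
      Tendsto (fun η : ℝ => (ΛN η : EReal)) atBot (𝓝 ΛN_bot) ∧
      (∀ (x : B) (y : ℝ), 0 < y →
        CompoundLDP.jointRate (CompoundLDP.logMGF P (X 0)) ΛN (x, y) =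
          (y : EReal) * CompoundLDP.legendreDual (CompoundLDP.logMGF P (X 0)) (y⁻¹ • x) +
            CompoundLDP.legendreReal ΛN y) ∧
      CompoundLDP.jointRate (CompoundLDP.logMGF P (X 0)) ΛN (0, 0) = -ΛN_bot ∧
      (∀ (x : B) (y : ℝ), ¬ 0 < y → (x, y) ≠ (0, 0) →
        CompoundLDP.jointRate (CompoundLDP.logMGF P (X 0)) ΛN (x, y) = ⊤) := by
  have hsc : SecondCountableTopology B := UniformSpace.secondCountable_of_separable B
  have hXNn : ∀ n, IndepFun (fun ω i => X i ω) (N n) P := fun n =>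
    hXN.comp (φ := id) measurable_id (measurable_pi_apply n)
  have hMGF := CompoundLDP.hasLimitingLogMGF_scaledPair hX_meas hX_indep hX_ident hX_exp hN_meas
    hXNn hΛN_lim
  have hZ := CompoundLDP.measurable_scaledPair hX_meas hN_meas
  have hT := CompoundLDP.exponentiallyTight_scaledPair hX_meas hX_indep hX_ident hX_exp hN_meas
    hXNn hΛN_lim hΛN_diff.continuous
  have hdiff := CompoundLDP.differentiable_compoundLogMGF
    (CompoundLDP.differentiable_logMGF (hX_meas 0) hX_exp) hΛN_diff
  have hN0 := CompoundLDP.counting_limit_zero hΛN_lim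
  have hmono := CompoundLDP.monotone_counting_limit hΛN_lim
  have h0 : CompoundLDP.compoundLogMGF (CompoundLDP.logMGF P (X 0)) ΛN 0 = 0 := by
    simp [CompoundLDP.compoundLogMGF, CompoundLDP.logMGF_zero, hN0]
  -- As `N n ≥ 0`, `ΛN` is monotone, so its limit at `-∞` is its infimum.
  refine ⟨?_, ?_, ⨅ η : ℝ, (ΛN η : EReal), ?_, ?_, ?_, ?_⟩
  · rw [CompoundLDP.jointRate_eq_legendreDual]
    exact hMGF.satisfiesLDP hZ hT hdiff h0
  · rw [CompoundLDP.jointRate_eq_legendreDual]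
    exact hMGF.isGoodRateFunction hZ hT hdiff h0
  · exact tendsto_atBot_iInf fun a b hab => EReal.coe_le_coe_iff.2 (hmono hab)
  · exact fun x y hy => CompoundLDP.jointRate_of_pos _ _ x hy
  · exact CompoundLDP.jointRate_zero _ _
  · intro x y hy hxy
    rcases (not_lt.1 hy).lt_or_eq with hy' | rfl
    · exact CompoundLDP.jointRate_of_neg (fun η hη => (hmono hη).trans_eq hN0) x hy'
    · exact CompoundLDP.jointRate_zero_right_of_ne _ _ fun hx => hxy (by rw [hx])
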